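/- Conventions. For a group $G$ write $[x,y]=x^{-1}y^{-1}xy$, $G'=\gamma_2(G)$ for the commutator subgroup, $G''=(G')'$, and $(\gamma_i(G))_{i\ge 1}$ for the lower central series. A group $G$ is a *$\sigma$-group of degree $d$* if it has an automorphism $\sigma$ of order exactly $d$ such that $\prod_{j=0}^{d-1}\sigma^j(x)\in G'$ for all $x\in G$. A $p$-group of order $p^n$ and nilpotency class $c$ has *coclass* $n-c$. For a finite $p$-group $G$ of class $c$, the parent is $G/\gamma_c(G)$; $G$ is an *immediate descendant* of $Q$ if its parent is isomorphic to $Q$ (where $\gamma_c(G)\neq 1$ is the last non-trivial term), and a *descendant* of $Q$ if $Q$ is isomorphic to $G$ or to an iterated parent of $G$, that is, if $G/\gamma_{n}(G)\simeq Q$ for some $n\ge 1$. A finite $p$-group is *capable* if it has an immediate descendant which is a finite $p$-group. A finite $p$-group is a *Schur $\sigma$-group* if it is a $\sigma$-group of degree $2$ (it has an automorphism of order $2$ acting as inversion on $G/G'$) and has a balanced presentation as a pro-$p$-group (as many relators as generators). For non-negative integers $k,l,m$ let $\Phi(k,l;m)$ be the group with generators $\alpha_1,\alpha_2,\beta,\beta_1,\beta_2$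 and relations $[\alpha_1,\alpha_2]=\beta$, $[\beta,\alpha_1]=\beta_1$, $[\beta,\alpha_2]=\beta_2$, all other commutators of generators trivial, $\beta^5=\beta_1^5=\beta_2^5=1$, $\alpha_1^5=\beta_1^{k}$, $\alpha_2^5=\beta_1^{m}\beta_2^{l}$. These groups have order $5^5=3125$, and in the notation of the SmallGroups library $\langle 3125,3\rangle=\Phi(0,0;0)$, $\langle 3125,4\rangle=\Phi(1,0;0)$, $\langle 3125,5\rangle=\Phi(0,0;1)$, $\langle 3125,6\rangle=\Phi(0,0;2)$, $\langle 3125,7\rangle=\Phi(4,1;0)$, $\langle 3125,11\rangle=\Phi(2,1;0)$, $\langle 3125,14\rangle=\Phi(1,1;0)$. **Theorem.** The groups $\langle 3125,11\rangle$ and $\langle 3125,14\rangle$ are Schur $\sigma$-groups, and the groups $\langle 3125,i\rangle$ with $i\in\{3,4,5,6,7\}$ are capable. Let $G$ be a finite metabelian $5$-group (that is, $G''=1$) with $G/G'\simeq C_5\times C_5$ which is a $\sigma$-group of degree $4$. Then - $G$ has coclass $1$, or - $G$ is isomorphic to one of the two Schur $\sigma$-groups $\langle 3125,11\rangle$, $\langle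 3125,14\rangle$, or - $G$ is isomorphic to a descendant of one of the capable groups $\langle 3125,i\rangle$ with $i\in\{3,4,5,6,7\}$. -/

import Mathlib

/-- `G` is a `σ`-group of degree `d`: it has an automorphism `σ` of order `d` such that the trace
`x ↦ x * σ x * σ² x * ⋯ * σ^(d-1) x` maps `G` into the commutator subgroup. -/
def IsSigmaGroup (d : ℕ) (G : Type*) [Group G] : Prop :=
  ∃ σ : MulAut G, orderOf σ = d ∧
    ∀ x : G, ((List.range d).map fun j => (σ ^ j) x).prod ∈ commutator G

/-- `G` is metabelian: its second derived subgroup `G''` is trivial. -/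
def IsMetabelian (G : Type*) [Group G] : Prop :=
  derivedSeries G 2 = ⊥

/-- The `p`-group `G` has coclass `r`: it is nilpotent of some class `c` and has order
`p ^ (c + r)`. -/
def HasCoclass (p : ℕ) (G : Type*) [Group G] (r : ℕ) : Prop :=
  Group.IsNilpotent G ∧ Nat.card G = p ^ (Group.nilpotencyClass G + r)

/-- `G` is a descendant of `Q` (`Q` itself included). The parent of a nilpotent group `G` of
class `c` is `G / γ_c(G)`, so the iterated parents of `G` are the quotients `G / γ_{n+1}(G)`,
where `γ_{n+1}(G)` is term number `n` of the lower central series in Mathlib;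
and `γ_{n+1}(G) = 1` for `n ≥ c`. -/
def IsDescendant (G : Type*) [Group G] (Q : Type*) [Group Q] : Prop :=
  ∃ n : ℕ, Nonempty (G ⧸ (⊤ : Subgroup G).lowerCentralSeries n ≃* Q)

/-- `G` is an immediate descendant of `Q`: `Q` is isomorphic to the quotient of `G` by the last
non-trivial term of its lower central series. -/
def IsImmediateDescendant (G : Type*) [Group G] (Q : Type*) [Group Q] : Prop :=
  ∃ n : ℕ, (⊤ : Subgroup G).lowerCentralSeries n ≠ ⊥ ∧
    (⊤ : Subgroup G).lowerCentralSeries (n + 1) = ⊥ ∧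
    Nonempty (G ⧸ (⊤ : Subgroup G).lowerCentralSeries n ≃* Q)

/-- `Q` is capable as a vertex of the descendant tree of finite `p`-groups: it has at least one
immediate descendant. -/
def IsCapable (p : ℕ) (Q : Type*) [Group Q] : Prop :=
  ∃ (H : Type) (_ : Group H), Finite H ∧ IsPGroup p H ∧ IsImmediateDescendant H Q

/-- `G` is presented, as a pro-`p`-group, by the `d` generators `φ (of i)` and the `r` relators
`rel j`, for some words `rel j` in the free group: the kernel of every homomorphism from the free
group to a finite `p`-group that kills the relators contains the kernel of `φ`. -/
def HasProPPresentation (p : ℕ) (G : Type*) [Group G] (d r : ℕ) : Prop :=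
  ∃ (φ : FreeGroup (Fin d) →* G) (rel : Fin r → FreeGroup (Fin d)),
    Function.Surjective φ ∧ (∀ j, φ (rel j) = 1) ∧
      ∀ (H : Type) [Group H] [Finite H], IsPGroup p H →
        ∀ ψ : FreeGroup (Fin d) →* H, (∀ j, ψ (rel j) = 1) → φ.ker ≤ ψ.ker

/-- `G` is a (finite) Schur `σ`-group: a finite `p`-group with an automorphism of order `2` that
acts as inversion on `G / G'`, and with a balanced presentation as a pro-`p`-group, that is, with
as many relators as generators. -/
def IsSchurSigmaGroup (p : ℕ) (G : Type*) [Group G] : Prop :=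
  Finite G ∧ IsPGroup p G ∧ IsSigmaGroup 2 G ∧ ∃ d : ℕ, HasProPPresentation p G d d

/-- Names for the generators `α₁, α₂, β, β₁, β₂` of the groups in the stem of the isoclinism
family `Φ₆`. -/
inductive Phi6Gen
  | a1 | a2 | b | b1 | b2

/-- The commutator `x⁻¹ y⁻¹ x y`. -/
def rightComm {G : Type*} [Group G] (x y : G) : G := x⁻¹ * y⁻¹ * x * y

open FreeGroup Phi6Gen in
/-- The relators of the group with generators `α₁, α₂, β, β₁, β₂` and relations
`[α₁, α₂] = β`, `[β, α₁] = β₁`, `[β, α₂] = β₂`, all other commutators of generators trivial,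
`β⁵ = β₁⁵ = β₂⁵ = 1`, `α₁⁵ = β₁^k₁₁ β₂^k₁₂`, `α₂⁵ = β₁^k₂₁ β₂^k₂₂`. -/
def phi6Rels (k₁₁ k₁₂ k₂₁ k₂₂ : ℕ) : Set (FreeGroup Phi6Gen) :=
  { rightComm (of a1) (of a2) * (of b)⁻¹,
    rightComm (of b) (of a1) * (of b1)⁻¹,
    rightComm (of b) (of a2) * (of b2)⁻¹,
    rightComm (of b1) (of a1), rightComm (of b1) (of a2), rightComm (of b1) (of b),
    rightComm (of b2) (of a1), rightComm (of b2) (of a2), rightComm (of b2) (of b),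
    rightComm (of b1) (of b2),
    of b ^ 5, of b1 ^ 5, of b2 ^ 5,
    of a1 ^ 5 * (of b1 ^ k₁₁ * of b2 ^ k₁₂)⁻¹,
    of a2 ^ 5 * (of b1 ^ k₂₁ * of b2 ^ k₂₂)⁻¹ }

/-- The group of order `5⁵` in the stem of `Φ₆` with `α₁⁵ = β₁^k₁₁ β₂^k₁₂` and
`α₂⁵ = β₁^k₂₁ β₂^k₂₂`. -/
abbrev Phi6Group (k₁₁ k₁₂ k₂₁ k₂₂ : ℕ) : Type :=
  PresentedGroup (phi6Rels k₁₁ k₁₂ k₂₁ k₂₂)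

/-- `⟨3125, 3⟩ = Φ₆(1⁵)`: `α₁⁵ = α₂⁵ = 1`. -/
abbrev G3125_3 : Type := Phi6Group 0 0 0 0

/-- `⟨3125, 4⟩ = Φ₆(21³)_a`: `α₁⁵ = β₁`, `α₂⁵ = 1`. -/
abbrev G3125_4 : Type := Phi6Group 1 0 0 0

/-- `⟨3125, 5⟩ = Φ₆(21³)_{b₁}`: `α₁⁵ = 1`, `α₂⁵ = β₁`. -/
abbrev G3125_5 : Type := Phi6Group 0 0 1 0

/-- `⟨3125, 6⟩ = Φ₆(21³)_{b₂}`: `α₁⁵ = 1`, `α₂⁵ = β₁²`. -/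
abbrev G3125_6 : Type := Phi6Group 0 0 2 0

/-- `⟨3125, 7⟩ = Φ₆(2²1)_{b₂}`: `α₁⁵ = β₁⁴`, `α₂⁵ = β₂`. -/
abbrev G3125_7 : Type := Phi6Group 4 0 0 1

/-- `⟨3125, 11⟩ = Φ₆(2²1)_{b₁}`: `α₁⁵ = β₁²`, `α₂⁵ = β₂`. -/
abbrev G3125_11 : Type := Phi6Group 2 0 0 1

/-- `⟨3125, 14⟩ = Φ₆(2²1)_a`: `α₁⁵ = β₁`, `α₂⁵ = β₂`. -/
abbrev G3125_14 : Type := Phi6Group 1 0 0 1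

/-!
Write `b = [x, y]` for generators `x`, `y` of a group `G` whose abelianization has type `(5, 5)`.
The factor `γ₂ / γ₃` is generated by `b`, the factor `γ₃ / γ₄` by `[b, x]` and `[b, y]`, and all
lower central factors involved have exponent five. Everything rests on collection formulas in
class at most four (`mul_pow_of_commute`, `rightComm_rightComm_of_class_three`).

*The groups `Φ₆`.* In class three the relations of exponent five on the commutators follow from
`x⁵, y⁵ ∈ γ₃` (`pow_five_eq_one_of_class_three`). So `Phi6Group` is the universal group of class
three on two generators with two power relations (`phi6Lift`), and its order divides `5⁵`.

*Rigidity.* If `x⁵ ≡ [b, x]ᵃ` and `y⁵ ≡ [b, y]ᵈ` modulo `γ₄`, then in class four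
`[b, x, x]ᵃ = 1`, `[b, y, y]ᵈ = 1`, `[b, x, y]ᵃ = b⁵` and `[b, x, y]ᵈ = b⁻⁵`. When `a`, `d` and
`a + d` are prime to five, this kills `γ₄` (`lcs_three_eq_bot`). Hence for `(a, d) = (2, 1)` and
`(1, 1)` the two power relations alone are a pro-`5` presentation, and these groups have no proper
descendants; the inversion of the generators provides the automorphism of order two.

*Capability.* In the other cases some fourfold commutator survives: a small group of class four
exhibiting it, multiplied by `Φ₆`, contains an immediate descendant (`isCapable_of_model`). The
models are a semidirect product of polynomials by translations and, for `(a, d) = (4, 1)`, a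
quotient of a pro-`5` Iwahori subgroup of `GL₂(ℤ₅)`.

*Classification.* If `[b, x]` and `[b, y]` are dependent modulo `γ₄`, generators can be chosen with
`[b, y] ∈ γ₄`; then in the metabelian case all lower central factors after the first have order at
most five, and the coclass is one (`hasCoclass_one`). Otherwise `G / γ₄` has order `5⁵`. The trace
condition makes `σ` diagonalizable on `G / G'` with eigenvalues `l, m ∈ {2, 3, 4}`, not both `-1`
because an involution acting trivially on `G / G'` would be trivial (`eq_one_of_sq_eq_one`). The
fifth power induces a `σ`-equivariant map from `G / G'` to `γ₃ / γ₄`, on which the eigenvalues are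
`l² m` and `l m²`. Comparing eigenvalues leaves, up to rescaling and exchanging the generators, only
the seven listed quotients, and rigidity applies to two of them.
-/

open scoped commutatorElement

/-- The lower central series of `G`, indexed from `0`: `lcs G n` is `γ_{n+1}(G)`. -/
abbrev lcs (G : Type*) [Group G] (n : ℕ) : Subgroup G := (⊤ : Subgroup G).lowerCentralSeries n

/-! ### Commutators and collection -/

section CommutatorCalculus

variable {G : Type*} [Group G]

theorem rightComm_eq (x y : G) : rightComm x y = ⁅x⁻¹, y⁻¹⁆ := by
  simp [rightComm, commutatorElement_def]

theorem map_rightComm {H F : Type*} [Group H] [FunLike F G H] [MonoidHomClass F G H] (f : F)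
    (x y : G) : f (rightComm x y) = rightComm (f x) (f y) := by
  simp [rightComm]

theorem rightComm_eq_one_iff {x y : G} : rightComm x y = 1 ↔ Commute x y := by
  rw [rightComm_eq, commutatorElement_eq_one_iff_commute, Commute.inv_inv_iff]

theorem rightComm_inv (x y : G) : (rightComm x y)⁻¹ = rightComm y x := by
  simp [rightComm, mul_assoc]

theorem mul_rightComm (x y : G) : x * rightComm x y = y⁻¹ * x * y := by
  simp [rightComm, mul_assoc]

theorem rightComm_mul_left (a b g : G) :
    rightComm (a * b) g = b⁻¹ * rightComm a g * b * rightComm b g := by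
  simp [rightComm, mul_assoc]

theorem rightComm_mul_right (a g h : G) :
    rightComm a (g * h) = rightComm a h * (h⁻¹ * rightComm a g * h) := by
  simp [rightComm, mul_assoc]

theorem rightComm_zpow_left {x g : G} (h : Commute x (rightComm x g)) (i : ℤ) :
    rightComm (x ^ i) g = rightComm x g ^ i := by
  have h1 : g⁻¹ * x ^ i * g = (g⁻¹ * x * g) ^ i := by
    simpa using (conj_zpow (a := g⁻¹) (b := x) (i := i)).symm
  have h2 : x ^ i * rightComm (x ^ i) g = x ^ i * rightComm x g ^ i := by
    rw [mul_rightComm, h1, ← mul_rightComm, h.mul_zpow]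
  exact mul_left_cancel h2

theorem rightComm_zpow_right {x g : G} (h : Commute x (rightComm g x)) (i : ℤ) :
    rightComm g (x ^ i) = rightComm g x ^ i := by
  rw [← rightComm_inv (x ^ i) g, rightComm_zpow_left, ← inv_zpow, rightComm_inv]
  rw [← rightComm_inv]
  exact h.inv_right

theorem rightComm_pow_left {x g : G} (h : Commute x (rightComm x g)) (i : ℕ) :
    rightComm (x ^ i) g = rightComm x g ^ i := by
  exact_mod_cast rightComm_zpow_left h i

/-- The collection formula for `(g * c) ^ n`, when the iterated commutators `c`, `[c, g]`,
`[c, g, g]` commute with one another and the last one commutes with `g`. -/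
theorem mul_pow_of_commute {g c c₁ c₂ : G} (h₁ : rightComm c g = c₁) (h₂ : rightComm c₁ g = c₂)
    (h₃ : Commute c₂ g) (h01 : Commute c c₁) (h02 : Commute c c₂) (h12 : Commute c₁ c₂) (n : ℕ) :
    (g * c) ^ n = g ^ n * (c ^ n * (c₁ ^ n.choose 2 * c₂ ^ n.choose 3)) := by
  have s0 : ∀ e : ℕ, c ^ e * g = g * (c ^ e * c₁ ^ e) := fun e ↦ by
    rw [← h01.mul_pow]
    have : SemiconjBy g (c * c₁) c := by
      rw [← h₁, mul_rightComm]; simp [SemiconjBy, mul_assoc]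
    exact (this.pow_right e).symm
  have s1 : ∀ e : ℕ, c₁ ^ e * g = g * (c₁ ^ e * c₂ ^ e) := fun e ↦ by
    rw [← h12.mul_pow]
    have : SemiconjBy g (c₁ * c₂) c₁ := by
      rw [← h₂, mul_rightComm]; simp [SemiconjBy, mul_assoc]
    exact (this.pow_right e).symm
  induction n with
  | zero => simp
  | succ n ih =>
    have e2 : (n + 1).choose 2 = n + n.choose 2 := by
      rw [Nat.choose_succ_succ' n 1, Nat.choose_one_right]
    have e3 : (n + 1).choose 3 = n.choose 2 + n.choose 3 := Nat.choose_succ_succ' n 2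
    calc (g * c) ^ (n + 1)
        = g ^ n * (c ^ n * (c₁ ^ n.choose 2 * (c₂ ^ n.choose 3 * g))) * c := by
          rw [pow_succ, ih]; simp only [mul_assoc]
      _ = g ^ n * (c ^ n * ((c₁ ^ n.choose 2 * g) * c₂ ^ n.choose 3)) * c := by
          rw [(h₃.pow_left _).eq]; simp only [mul_assoc]
      _ = g ^ n * ((c ^ n * g) * (c₁ ^ n.choose 2 * (c₂ ^ n.choose 2 * c₂ ^ n.choose 3))) * c := by
          rw [s1]; simp only [mul_assoc]
      _ = g ^ n * (g * (c ^ n * ((c₁ ^ n * (c₁ ^ n.choose 2 *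
            (c₂ ^ n.choose 2 * c₂ ^ n.choose 3))) * c))) := by
          rw [s0]; simp only [mul_assoc]
      _ = g ^ n * (g * (c ^ n * (c * (c₁ ^ n * (c₁ ^ n.choose 2 *
            (c₂ ^ n.choose 2 * c₂ ^ n.choose 3)))))) := by
          rw [((h01.pow_right _).mul_right ((h01.pow_right _).mul_right
            ((h02.pow_right _).mul_right (h02.pow_right _)))).eq]
      _ = _ := by
          rw [e2, e3, pow_succ, pow_succ, pow_add c₁, pow_add c₂]; simp only [mul_assoc]

theorem rightComm_pow_five {x y b c d : G} (hb : rightComm x y = b) (hc : rightComm b x = c)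
    (hd : rightComm c x = d) (h₃ : Commute d x) (h01 : Commute b c) (h02 : Commute b d)
    (h12 : Commute c d) : rightComm (x ^ 5) y = b ^ 5 * (c ^ 10 * d ^ 10) := by
  have h := mul_pow_of_commute hc hd h₃ h01 h02 h12 5
  have h1 : y⁻¹ * x ^ 5 * y = (y⁻¹ * x * y) ^ 5 := by
    simpa using (conj_pow (a := y⁻¹) (b := x) (i := 5)).symm
  have h2 : x ^ 5 * rightComm (x ^ 5) y = (x * b) ^ 5 := by
    rw [mul_rightComm, h1, ← mul_rightComm, hb]
  rw [h] at h2
  exact mul_left_cancel h2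

end CommutatorCalculus

/-! ### The lower central series -/

section LowerCentralSeries

variable {G : Type*} [Group G]

theorem rightComm_mem_lcs_left {n : ℕ} {a : G} (ha : a ∈ lcs G n) (g : G) :
    rightComm a g ∈ lcs G (n + 1) := by
  rw [rightComm_eq]
  exact Subgroup.commutator_mem_commutator (inv_mem ha) (Subgroup.mem_top _)

theorem rightComm_mem_lcs_one (x y : G) : rightComm x y ∈ lcs G 1 :=
  rightComm_mem_lcs_left (n := 0) (Subgroup.mem_top x) y

theorem lcs_le {m n : ℕ} (h : m ≤ n) : lcs G n ≤ lcs G m :=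
  Subgroup.lowerCentralSeries_antitone _ h

theorem map_lcs {H : Type*} [Group H] (f : G →* H) (hf : Function.Surjective f) (n : ℕ) :
    (lcs G n).map f = lcs H n := by
  rw [Subgroup.map_lowerCentralSeries, Subgroup.map_top_of_surjective f hf]

theorem map_mem_lcs {H : Type*} [Group H] (f : G →* H) {n : ℕ} {a : G} (ha : a ∈ lcs G n) :
    f a ∈ lcs H n :=
  Subgroup.lowerCentralSeries_mono n le_top
    (Subgroup.map_lowerCentralSeries ⊤ f n ▸ Subgroup.mem_map_of_mem f ha)

theorem lcs_quotient (n m : ℕ) :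
    lcs (G ⧸ lcs G n) m = (lcs G m).map (QuotientGroup.mk' (lcs G n)) :=
  (map_lcs _ (QuotientGroup.mk'_surjective _) m).symm

theorem lcs_quotient_self (n : ℕ) : lcs (G ⧸ lcs G n) n = ⊥ := by
  rw [lcs_quotient, Subgroup.map_eq_bot_iff, QuotientGroup.ker_mk']

theorem mk_mem_lcs_iff {n m : ℕ} (h : m ≤ n) {a : G} :
    (a : G ⧸ lcs G n) ∈ lcs (G ⧸ lcs G n) m ↔ a ∈ lcs G m := by
  rw [lcs_quotient, ← QuotientGroup.mk'_apply, ← Subgroup.mem_comap, Subgroup.comap_map_eq,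
    QuotientGroup.ker_mk', sup_eq_left.mpr (lcs_le h)]

theorem commute_of_lcs_succ {n : ℕ} (h : lcs G (n + 1) = ⊥) {a : G} (ha : a ∈ lcs G n) (g : G) :
    Commute a g := by
  rw [← rightComm_eq_one_iff, ← Subgroup.mem_bot, ← h]
  exact rightComm_mem_lcs_left ha g

theorem lcs_one_eq_commutator : lcs G 1 = commutator G := Subgroup.top_lowerCentralSeries_one

/-- The second centre centralizes the commutator subgroup: for `a` in it, `g ↦ [a, g]` is a
homomorphism to the centre. -/
theorem commute_of_lcs_add_two {n : ℕ} (h : lcs G (n + 2) = ⊥) {a b : G} (ha : a ∈ lcs G n)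
    (hb : b ∈ lcs G 1) : Commute a b := by
  have hc : ∀ g u, Commute (rightComm a g) u := fun g u ↦
    commute_of_lcs_succ h (rightComm_mem_lcs_left ha g) u
  let f : G →* Subgroup.center G :=
    MonoidHom.mk' (fun g ↦ ⟨rightComm a g, Subgroup.mem_center_iff.mpr fun u ↦ (hc g u).eq.symm⟩)
      fun g k ↦ by
        ext
        simp only [Subgroup.coe_mul]
        rw [rightComm_mul_right, mul_assoc, (hc g k).eq, inv_mul_cancel_left, (hc g _).eq]
  have h1 : f b = 1 := by
    rw [lcs_one_eq_commutator] at hb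
    have h2 : commutator G ≤ f.ker := Subgroup.commutator_le.mpr fun u _ v _ ↦ by
      rw [MonoidHom.mem_ker, map_commutatorElement, commutatorElement_eq_one_iff_mul_comm]
      exact Subtype.ext (hc u _).eq
    exact h2 hb
  rw [← rightComm_eq_one_iff]
  exact congrArg Subtype.val h1

theorem normal_of_lcs_le {n : ℕ} {N : Subgroup G} (h₁ : lcs G (n + 1) ≤ N) (h₂ : N ≤ lcs G n) :
    N.Normal := by
  refine ⟨fun a ha g ↦ ?_⟩
  have h := N.mul_mem ha (h₁ (rightComm_mem_lcs_left (h₂ ha) g⁻¹))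
  rwa [mul_rightComm, inv_inv] at h

/-- Commutators with a normal subgroup as target can be tested on generators of both sides. -/
theorem rightComm_mem_of_closure {S T : Set G} {N : Subgroup G} [hN : N.Normal]
    (h : ∀ t ∈ T, ∀ s ∈ S, rightComm t s ∈ N) {a g : G} (ha : a ∈ Subgroup.closure T)
    (hg : g ∈ Subgroup.closure S) : rightComm a g ∈ N := by
  have key : ∀ t u : G, rightComm t u ∈ N ↔ Commute (t : G ⧸ N) (u : G ⧸ N) := fun t u ↦ by
    rw [← rightComm_eq_one_iff, ← QuotientGroup.eq_one_iff]
    rw [← QuotientGroup.mk'_apply, map_rightComm]; rfl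
  simp only [key] at h ⊢
  induction ha using Subgroup.closure_induction with
  | mem t ht =>
    induction hg using Subgroup.closure_induction with
    | mem s hs => exact h t ht s hs
    | one => exact Commute.one_right _
    | mul u v _ _ hu hv => exact hu.mul_right hv
    | inv u _ hu => exact hu.inv_right
  | one => exact Commute.one_left _
  | mul u v _ _ hu hv => exact hu.mul_left hv
  | inv u _ hu => exact hu.inv_left

theorem commute_of_closure_eq_top {S : Set G} (hS : Subgroup.closure S = ⊤) {a : G}
    (h : ∀ s ∈ S, Commute a s) (g : G) : Commute a g := by
  have : a ∈ Subgroup.centralizer (Subgroup.closure S : Set G) := by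
    rw [Subgroup.centralizer_closure, Subgroup.mem_centralizer_iff]
    exact fun s hs ↦ (h s hs).eq.symm
  exact (Subgroup.mem_centralizer_iff.mp this g (hS ▸ Subgroup.mem_top g)).symm

theorem lcs_succ_le {S T : Set G} {n : ℕ} {N : Subgroup G} [N.Normal]
    (hS : Subgroup.closure S = ⊤) (hT : lcs G n ≤ Subgroup.closure T)
    (h : ∀ t ∈ T, ∀ s ∈ S, rightComm t s ∈ N) : lcs G (n + 1) ≤ N := by
  refine Subgroup.commutator_le.mpr fun a ha g _ ↦ ?_
  have := rightComm_mem_of_closure h (hT (inv_mem ha)) (g := g⁻¹) (hS ▸ Subgroup.mem_top _)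
  simpa [rightComm_eq] using this

variable {x y : G}

theorem lcs_one_le (hS : Subgroup.closure {x, y} = ⊤) :
    lcs G 1 ≤ lcs G 2 ⊔ Subgroup.zpowers (rightComm x y) := by
  have hb : rightComm x y ∈ lcs G 2 ⊔ Subgroup.zpowers (rightComm x y) :=
    Subgroup.mem_sup_right (Subgroup.mem_zpowers _)
  have hN : (lcs G 2 ⊔ Subgroup.zpowers (rightComm x y)).Normal :=
    normal_of_lcs_le (n := 1) le_sup_left
      (sup_le (lcs_le one_le_two) (by simpa using rightComm_mem_lcs_one x y))
  refine lcs_succ_le (n := 0) (T := {x, y}) hS (by rw [hS]; exact le_top) ?_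
  have h1 : ∀ u : G, rightComm u u = 1 := fun u ↦ rightComm_eq_one_iff.mpr (Commute.refl u)
  have hb' := inv_mem hb
  rw [rightComm_inv] at hb'
  rintro t (rfl | rfl) s (rfl | rfl)
  exacts [(h1 _).symm ▸ one_mem _, hb, hb', (h1 _).symm ▸ one_mem _]

theorem lcs_two_le (hS : Subgroup.closure {x, y} = ⊤) :
    lcs G 2 ≤ lcs G 3 ⊔ Subgroup.zpowers (rightComm (rightComm x y) x) ⊔
      Subgroup.zpowers (rightComm (rightComm x y) y) := by
  have h1 := rightComm_mem_lcs_one x y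
  have hN : (lcs G 3 ⊔ Subgroup.zpowers (rightComm (rightComm x y) x) ⊔
      Subgroup.zpowers (rightComm (rightComm x y) y)).Normal :=
    normal_of_lcs_le (n := 2) (le_sup_left.trans le_sup_left)
      (sup_le (sup_le (lcs_le (by norm_num)) (by simpa using rightComm_mem_lcs_left h1 x))
        (by simpa using rightComm_mem_lcs_left h1 y))
  refine lcs_succ_le (n := 1) (T := {rightComm x y} ∪ lcs G 2) hS ?_ ?_
  · refine (lcs_one_le hS).trans (sup_le ?_ ?_)
    · exact fun a ha ↦ Subgroup.subset_closure (Or.inr ha)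
    · exact (Subgroup.zpowers_le).mpr (Subgroup.subset_closure (Or.inl rfl))
  · rintro t (rfl | ht) s hs
    · rcases hs with rfl | rfl
      · exact Subgroup.mem_sup_left (Subgroup.mem_sup_right (Subgroup.mem_zpowers _))
      · exact Subgroup.mem_sup_right (Subgroup.mem_zpowers _)
    · exact Subgroup.mem_sup_left (Subgroup.mem_sup_left (rightComm_mem_lcs_left ht s))

theorem lcs_three_le (hS : Subgroup.closure {x, y} = ⊤) {N : Subgroup G} [N.Normal]
    (h4 : lcs G 4 ≤ N)
    (h : ∀ s ∈ ({x, y} : Set G), ∀ t ∈ ({x, y} : Set G),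
      rightComm (rightComm (rightComm x y) s) t ∈ N) : lcs G 3 ≤ N := by
  refine lcs_succ_le (n := 2)
    (T := {rightComm (rightComm x y) x, rightComm (rightComm x y) y} ∪ lcs G 3) hS ?_ ?_
  · refine (lcs_two_le hS).trans (sup_le (sup_le ?_ ?_) ?_)
    · exact fun a ha ↦ Subgroup.subset_closure (Or.inr ha)
    · exact (Subgroup.zpowers_le).mpr (Subgroup.subset_closure (Or.inl (Or.inl rfl)))
    · exact (Subgroup.zpowers_le).mpr (Subgroup.subset_closure (Or.inl (Or.inr rfl)))
  · rintro t ((rfl | rfl) | ht) s hs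
    · exact h x (by simp) s hs
    · exact h y (by simp) s hs
    · exact h4 (rightComm_mem_lcs_left ht s)

/-- In a nilpotent group the lower central series is stationary only at the trivial group. -/
theorem lcs_eq_bot_of_le_succ [Group.IsNilpotent G] {n : ℕ} (h : lcs G n ≤ lcs G (n + 1)) :
    lcs G n = ⊥ := by
  have key : ∀ k, lcs G n ≤ lcs G (n + k) := by
    intro k
    induction k with
    | zero => exact le_rfl
    | succ k ih => exact h.trans (Subgroup.commutator_mono ih le_rfl)
  obtain ⟨m, hm⟩ := Subgroup.nilpotent_iff_lowerCentralSeries.mp ‹Group.IsNilpotent G›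
  exact le_bot_iff.mp ((key m).trans ((lcs_le (Nat.le_add_left m n)).trans hm.le))

/-- A subgroup supplementing the commutator subgroup of a finite nilpotent group is the whole
group: every maximal subgroup is normal of prime index, so it contains the commutator subgroup. -/
theorem eq_top_of_sup_commutator [Finite G] [Group.IsNilpotent G] {H : Subgroup G}
    (h : H ⊔ commutator G = ⊤) : H = ⊤ := by
  by_contra hH
  obtain ⟨M, hM, hHM⟩ := (eq_top_or_exists_le_coatom H).resolve_left hH
  have hn : M.Normal := Subgroup.NormalizerCondition.normal_of_coatom M
    (Group.normalizerCondition_of_isNilpotent) hM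
  have hne : Nontrivial (G ⧸ M) := QuotientGroup.nontrivial_iff.mpr hM.1
  have hc : (Subgroup.center (G ⧸ M)).comap (QuotientGroup.mk' M) = ⊤ := by
    refine hM.2 _ (lt_of_le_of_ne ?_ ?_)
    · intro a ha
      have : (a : G ⧸ M) = 1 := (QuotientGroup.eq_one_iff a).mpr ha
      simp [this]
    · intro he
      refine Group.IsNilpotent.center_ne_bot (G := G ⧸ M) ?_
      refine Subgroup.comap_injective (QuotientGroup.mk'_surjective M) ?_
      rw [← he, MonoidHom.comap_bot, QuotientGroup.ker_mk']
  have hle : commutator G ≤ M := by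
    refine Subgroup.commutator_le.mpr fun a _ b _ ↦ ?_
    rw [← QuotientGroup.eq_one_iff, ← QuotientGroup.mk'_apply, map_commutatorElement,
      commutatorElement_eq_one_iff_mul_comm]
    have ha : a ∈ (Subgroup.center (G ⧸ M)).comap (QuotientGroup.mk' M) := hc ▸ Subgroup.mem_top a
    exact ((Subgroup.mem_center_iff.mp ha) _).symm
  exact hM.1 (top_le_iff.mp (h ▸ sup_le hHM hle))

end LowerCentralSeries

/-! ### Groups of class at most three -/

section SmallClass

variable {G : Type*} [Group G]

theorem rightComm_mul_central_left {c : G} (hc : ∀ u, Commute c u) (a g : G) :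
    rightComm (a * c) g = rightComm a g := by
  rw [rightComm_mul_left, rightComm_eq_one_iff.mpr (hc g), mul_one, mul_assoc,
    ← (hc _).eq, inv_mul_cancel_left]

theorem rightComm_mul_central_right {c : G} (hc : ∀ u, Commute c u) (a g : G) :
    rightComm a (g * c) = rightComm a g := by
  rw [← rightComm_inv, rightComm_mul_central_left hc, rightComm_inv]

/-- In class two the commutator is bilinear, and depends only on the classes modulo `G'`. -/
theorem rightComm_of_class_two (h : lcs G 2 = ⊥) (x y : G) (i j : ℤ) {c d : G}
    (hc : c ∈ lcs G 1) (hd : d ∈ lcs G 1) :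
    rightComm (x ^ i * c) (y ^ j * d) = rightComm x y ^ (i * j) := by
  have hz := fun {a : G} (ha : a ∈ lcs G 1) ↦ commute_of_lcs_succ h ha
  rw [rightComm_mul_central_left (hz hc), rightComm_mul_central_right (hz hd),
    rightComm_zpow_left (hz (rightComm_mem_lcs_one _ _) _).symm,
    rightComm_zpow_right (hz (rightComm_mem_lcs_one _ _) _).symm, ← zpow_mul, mul_comm]

theorem exists_rightComm_eq (x y : G) (i j : ℤ) {c d : G} (hc : c ∈ lcs G 1) (hd : d ∈ lcs G 1) :
    ∃ e ∈ lcs G 2, rightComm (x ^ i * c) (y ^ j * d) = rightComm x y ^ (i * j) * e := by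
  have h := rightComm_of_class_two (lcs_quotient_self (G := G) 2) (x : G ⧸ lcs G 2) y i j
    ((mk_mem_lcs_iff one_le_two).mpr hc) ((mk_mem_lcs_iff one_le_two).mpr hd)
  refine ⟨(rightComm x y ^ (i * j))⁻¹ * rightComm (x ^ i * c) (y ^ j * d), ?_, by simp⟩
  rw [← QuotientGroup.eq_one_iff, ← QuotientGroup.mk'_apply, map_mul, map_inv, map_zpow,
    map_rightComm, map_rightComm]
  exact inv_mul_eq_one.mpr h.symm

/-- In class three the triple commutator is trilinear, and depends only on the classes
modulo `G'`. -/
theorem rightComm_rightComm_of_class_three (h : lcs G 3 = ⊥) (x y z : G) (i j k : ℤ) {c d f : G}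
    (hc : c ∈ lcs G 1) (hd : d ∈ lcs G 1) (hf : f ∈ lcs G 1) :
    rightComm (rightComm (x ^ i * c) (y ^ j * d)) (z ^ k * f) =
      rightComm (rightComm x y) z ^ (i * j * k) := by
  obtain ⟨e, he, h1⟩ := exists_rightComm_eq x y i j hc hd
  have hz := fun {a : G} (ha : a ∈ lcs G 2) ↦ commute_of_lcs_succ h ha
  have hb := rightComm_mem_lcs_one x y
  have hu : rightComm x y ^ (i * j) ∈ lcs G 1 := zpow_mem hb _
  rw [h1, rightComm_mul_central_left (hz he), rightComm_mul_right,
    rightComm_eq_one_iff.mpr (commute_of_lcs_add_two h hu hf), one_mul, mul_assoc,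
    (hz (rightComm_mem_lcs_left hu _) f).eq, inv_mul_cancel_left,
    rightComm_zpow_right (hz (rightComm_mem_lcs_left hu _) _).symm,
    rightComm_zpow_left (hz (rightComm_mem_lcs_left hb _) _).symm, ← zpow_mul]

/-- The relations of exponent five on the commutators are forced in class three. -/
theorem pow_five_eq_one_of_class_three (h : lcs G 3 = ⊥) {x : G} (y : G) (hx : x ^ 5 ∈ lcs G 2) :
    rightComm x y ^ 5 = 1 ∧ rightComm (rightComm x y) x ^ 5 = 1 ∧
      rightComm (rightComm x y) y ^ 5 = 1 := by
  have hz := fun {a : G} (ha : a ∈ lcs G 2) ↦ commute_of_lcs_succ h ha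
  have hb := rightComm_mem_lcs_one x y
  have hc := fun g ↦ rightComm_mem_lcs_left hb g
  have hp : ∀ g, rightComm (rightComm x y ^ 5) g = rightComm (rightComm x y) g ^ 5 := fun g ↦
    rightComm_pow_left (hz (hc g) _).symm 5
  have h1 := rightComm_pow_five (x := x) (y := y) (d := 1) rfl rfl
    (rightComm_eq_one_iff.mpr (hz (hc x) x)) (Commute.one_left _) (hz (hc x) _).symm
    (Commute.one_right _) (Commute.one_right _)
  rw [rightComm_eq_one_iff.mpr (hz hx y), one_pow, mul_one] at h1
  have hb5 : rightComm x y ^ 5 ∈ lcs G 2 := by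
    rw [eq_inv_of_mul_eq_one_left h1.symm]
    exact inv_mem (pow_mem (hc x) 10)
  have h2 : ∀ g, rightComm (rightComm x y) g ^ 5 = 1 := fun g ↦ by
    rw [← hp, rightComm_eq_one_iff.mpr (hz hb5 g)]
  refine ⟨?_, h2 x, h2 y⟩
  rw [show (10 : ℕ) = 5 * 2 from rfl, pow_mul, h2 x, one_pow, mul_one] at h1
  exact h1.symm

/-- In class three the fifth power of an element depends only on its class modulo `G'`, when the
commutator subgroup has exponent five. -/
theorem mul_pow_five_of_class_three (h : lcs G 3 = ⊥) {c : G} (g : G)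
    (h5 : ∀ a ∈ lcs G 1, a ^ 5 = 1) (hc : c ∈ lcs G 1) : (g * c) ^ 5 = g ^ 5 := by
  have hz := fun {a : G} (ha : a ∈ lcs G 2) ↦ commute_of_lcs_succ h ha
  have hcg := rightComm_mem_lcs_left hc g
  have h1 := mul_pow_of_commute (g := g) (c := c) (c₂ := 1) rfl
    (rightComm_eq_one_iff.mpr (hz hcg g)) (Commute.one_left _) (hz hcg _).symm
    (Commute.one_right _) (Commute.one_right _) 5
  rw [h1, h5 c hc, one_pow, one_mul, mul_one, show Nat.choose 5 2 = 5 * 2 from rfl, pow_mul,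
    h5 _ (lcs_le one_le_two hcg), one_pow, mul_one]

/-- `[c, x, y] = [c, y, x]` as soon as the conjugates of `c` commute with `[x, y]`. -/
theorem rightComm_rightComm_comm {c x y : G} (h₁ : Commute (rightComm c x) (rightComm c y))
    (h₂ : Commute (c * rightComm c (y * x)) (rightComm x y)) :
    rightComm (rightComm c x) y = rightComm (rightComm c y) x := by
  have e1 : ∀ u v : G, v⁻¹ * (u⁻¹ * c * u) * v =
      c * rightComm c v * (rightComm c u * rightComm (rightComm c u) v) := fun u v ↦ by
    simp [rightComm, mul_assoc]
  have e2 : y⁻¹ * (x⁻¹ * c * x) * y = x⁻¹ * (y⁻¹ * c * y) * x := by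
    rw [mul_rightComm] at h₂
    have h3 := h₂.symm.eq
    rw [← eq_inv_mul_iff_mul_eq] at h3
    rw [show x⁻¹ * (y⁻¹ * c * y) * x = (y * x)⁻¹ * c * (y * x) by simp [mul_assoc]]
    rw [h3]
    simp [rightComm, mul_assoc]
  rw [e1, e1, mul_assoc, mul_assoc, ← mul_assoc (rightComm c y), ← mul_assoc (rightComm c x),
    h₁.eq] at e2
  exact mul_left_cancel (mul_left_cancel e2)

end SmallClass

/-! ### Power relations that force class three -/

section Rigidity

variable {G : Type*} [Group G] {x y : G}

/-- The consequences in class four of a relation `x⁵ ≡ [x, y, x]ᵃ` modulo `γ₄`. -/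
theorem class_four_relations (h : lcs G 4 = ⊥) {a : ℤ} {z : G} (hz : z ∈ lcs G 3)
    (hx : x ^ 5 = rightComm (rightComm x y) x ^ a * z) :
    rightComm x y ^ 5 = rightComm (rightComm (rightComm x y) x) y ^ a ∧
      rightComm (rightComm (rightComm x y) x) x ^ a = 1 ∧
      (∀ g, rightComm (rightComm x y) g ^ 5 = 1) ∧
      ∀ g k, rightComm (rightComm (rightComm x y) g) k ^ 5 = 1 := by
  have cen := fun {a : G} (ha : a ∈ lcs G 3) ↦ commute_of_lcs_succ h ha
  have com := fun {a b : G} (ha : a ∈ lcs G 2) (hb : b ∈ lcs G 1) ↦ commute_of_lcs_add_two h ha hb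
  set b := rightComm x y with hb
  have b_mem : b ∈ lcs G 1 := rightComm_mem_lcs_one x y
  have c_mem := fun g ↦ rightComm_mem_lcs_left b_mem g
  have d_mem := fun g k ↦ rightComm_mem_lcs_left (c_mem g) k
  have c_pow : ∀ (g : G) (n : ℤ), rightComm (b ^ n) g = rightComm b g ^ n := fun g ↦
    rightComm_zpow_left (com (c_mem g) b_mem).symm
  have d_pow : ∀ (g k : G) (n : ℤ), rightComm (rightComm b g ^ n) k =
      rightComm (rightComm b g) k ^ n := fun g k ↦
    rightComm_zpow_left (cen (d_mem g k) _).symm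
  have x5 : x ^ 5 ∈ lcs G 2 := hx ▸ mul_mem (zpow_mem (c_mem x) a) (lcs_le (by norm_num) hz)
  have x5c : ∀ g, rightComm (x ^ 5) g = rightComm (rightComm b x) g ^ a := fun g ↦ by
    rw [hx, rightComm_mul_central_left (cen hz), d_pow]
  have e := rightComm_pow_five (x := x) (y := y) rfl rfl rfl (cen (d_mem x x) _)
    (com (c_mem x) b_mem).symm (cen (d_mem x x) _).symm (cen (d_mem x x) _).symm
  rw [← hb] at e
  -- Descent: `b⁵` lies in `γ₃`, so `[b, g]⁵` lies in `γ₄`, so `[b, g, k]⁵` is trivial.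
  have b5 : b ^ 5 ∈ lcs G 2 := by
    rw [eq_mul_inv_of_mul_eq e.symm]
    exact mul_mem (lcs_le (by norm_num) (rightComm_mem_lcs_left x5 y)) (inv_mem (mul_mem
      (pow_mem (c_mem x) _) (pow_mem (lcs_le (by norm_num) (d_mem x x)) _)))
  have c5 : ∀ g, rightComm b g ^ 5 ∈ lcs G 3 := fun g ↦ by
    have := c_pow g 5
    norm_cast at this
    exact this ▸ rightComm_mem_lcs_left b5 g
  have d5 : ∀ g k, rightComm (rightComm b g) k ^ 5 = 1 := fun g k ↦ by
    have := d_pow g k 5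
    norm_cast at this
    rw [← this, rightComm_eq_one_iff.mpr (cen (c5 g) k)]
  -- Feeding this back, `b⁵` lies in `γ₄`, so `[b, g]⁵` is trivial.
  have c10 : ∀ g, rightComm b g ^ 10 ∈ lcs G 3 := fun g ↦ by
    rw [show (10 : ℕ) = 5 * 2 from rfl, pow_mul]; exact pow_mem (c5 g) 2
  have b5' : b ^ 5 ∈ lcs G 3 := by
    rw [eq_mul_inv_of_mul_eq e.symm]
    exact mul_mem (rightComm_mem_lcs_left x5 y) (inv_mem (mul_mem (c10 x) (pow_mem (d_mem x x) _)))
  have c5' : ∀ g, rightComm b g ^ 5 = 1 := fun g ↦ by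
    have := c_pow g 5
    norm_cast at this
    rw [← this, rightComm_eq_one_iff.mpr (cen b5' g)]
  refine ⟨?_, ?_, c5', d5⟩
  · rw [show (10 : ℕ) = 5 * 2 from rfl, pow_mul, pow_mul, c5', d5] at e
    rw [← x5c, e]; simp
  · rw [← x5c, rightComm_eq_one_iff]
    exact Commute.pow_left (Commute.refl x) 5

theorem eq_one_of_zpow_of_pow_five {g : G} {a : ℤ} (ha : ¬ (5 : ℤ) ∣ a) (h : g ^ a = 1)
    (h5 : g ^ 5 = 1) : g = 1 := by
  have hc : IsCoprime a 5 := ((Prime.coprime_iff_not_dvd (by norm_num)).mpr ha).symm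
  obtain ⟨u, v, huv⟩ := hc
  rw [← zpow_one g, ← huv, zpow_add, mul_comm u, mul_comm v, zpow_mul, zpow_mul, h]
  have : g ^ (5 : ℤ) = 1 := by exact_mod_cast h5
  simp [this]

theorem lcs_three_eq_bot_of_class_four (h : lcs G 4 = ⊥) (hS : Subgroup.closure {x, y} = ⊤)
    {a b : ℤ} (ha : ¬ (5 : ℤ) ∣ a) (hb : ¬ (5 : ℤ) ∣ b) (hab : ¬ (5 : ℤ) ∣ a + b)
    {z w : G} (hz : z ∈ lcs G 3) (hw : w ∈ lcs G 3)
    (hx : x ^ 5 = rightComm (rightComm x y) x ^ a * z)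
    (hy : y ^ 5 = rightComm (rightComm x y) y ^ b * w) : lcs G 3 = ⊥ := by
  have com := fun {a b : G} (ha : a ∈ lcs G 2) (hb : b ∈ lcs G 1) ↦ commute_of_lcs_add_two h ha hb
  have cen := fun {a : G} (ha : a ∈ lcs G 3) ↦ commute_of_lcs_succ h ha
  have b_mem := rightComm_mem_lcs_one x y
  have c_mem := fun g ↦ rightComm_mem_lcs_left b_mem g
  have d_mem := fun g k ↦ rightComm_mem_lcs_left (c_mem g) k
  obtain ⟨x1, x2, -, x4⟩ := class_four_relations h hz hx
  have e1 : ∀ g, rightComm (rightComm y x) g = (rightComm (rightComm x y) g)⁻¹ := fun g ↦ by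
    have := rightComm_zpow_left (com (c_mem g) b_mem).symm (-1)
    rwa [zpow_neg_one, zpow_neg_one, rightComm_inv] at this
  have e2 : ∀ g k, rightComm (rightComm (rightComm y x) g) k =
      (rightComm (rightComm (rightComm x y) g) k)⁻¹ := fun g k ↦ by
    have := rightComm_zpow_left (cen (d_mem g k) _).symm (-1)
    rwa [zpow_neg_one, zpow_neg_one, ← e1] at this
  have hy' : y ^ 5 = rightComm (rightComm y x) y ^ (-b) * w := by rw [e1, hy]; simp
  obtain ⟨y1, y2, -, -⟩ := class_four_relations h hw hy'
  have sym : rightComm (rightComm (rightComm x y) x) y =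
      rightComm (rightComm (rightComm x y) y) x :=
    rightComm_rightComm_comm (com (c_mem x) (lcs_le one_le_two (c_mem y)))
      ((Commute.refl _).mul_left (com (c_mem _) b_mem))
  -- The two power relations give `b⁵ = [b, x, y]ᵃ` and `b⁻⁵ = [b, x, y]ᵇ`.
  have dxy : rightComm (rightComm (rightComm x y) x) y = 1 := by
    refine eq_one_of_zpow_of_pow_five hab ?_ (x4 x y)
    rw [e2, ← sym, ← rightComm_inv, inv_zpow', neg_neg, inv_pow] at y1
    rw [zpow_add, ← x1, ← y1, mul_inv_cancel]
  have dxx : rightComm (rightComm (rightComm x y) x) x = 1 :=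
    eq_one_of_zpow_of_pow_five ha x2 (x4 x x)
  have dyy : rightComm (rightComm (rightComm x y) y) y = 1 := by
    refine eq_one_of_zpow_of_pow_five hb ?_ (x4 y y)
    rwa [e2, inv_zpow', neg_neg] at y2
  refine le_bot_iff.mp (lcs_three_le hS h.le ?_)
  rintro s (rfl | rfl) t (rfl | rfl)
  exacts [dxx, dxy, sym ▸ dxy, dyy]

/-- A nilpotent group with generators satisfying `x⁵ ≡ [x, y, x]ᵃ` and `y⁵ ≡ [x, y, y]ᵇ` modulo
`γ₄`, where `a`, `b`, `a + b` are prime to `5`, has class at most three. -/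
theorem lcs_three_eq_bot [Group.IsNilpotent G] (hS : Subgroup.closure {x, y} = ⊤)
    {a b : ℤ} (ha : ¬ (5 : ℤ) ∣ a) (hb : ¬ (5 : ℤ) ∣ b) (hab : ¬ (5 : ℤ) ∣ a + b)
    {z w : G} (hz : z ∈ lcs G 3) (hw : w ∈ lcs G 3)
    (hx : x ^ 5 = rightComm (rightComm x y) x ^ a * z)
    (hy : y ^ 5 = rightComm (rightComm x y) y ^ b * w) : lcs G 3 = ⊥ := by
  refine lcs_eq_bot_of_le_succ ?_
  let π := QuotientGroup.mk' (lcs G 4)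
  have hS' : Subgroup.closure {π x, π y} = ⊤ := by
    rw [← Set.image_pair, ← MonoidHom.map_closure, hS,
      Subgroup.map_top_of_surjective _ (QuotientGroup.mk'_surjective _)]
  have key := lcs_three_eq_bot_of_class_four (lcs_quotient_self (G := G) 4) hS' ha hb hab
    (map_mem_lcs π hz) (map_mem_lcs π hw)
    (by rw [← map_pow, hx]; simp only [map_mul, map_zpow, map_rightComm])
    (by rw [← map_pow, hy]; simp only [map_mul, map_zpow, map_rightComm])
  intro g hg
  rw [← QuotientGroup.eq_one_iff, ← Subgroup.mem_bot, ← key]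
  exact map_mem_lcs π hg

end Rigidity

/-! ### Orders of the lower central factors -/

section Orders

variable {G : Type*} [Group G] {x y : G}

theorem index_dvd_of_le_sup_zpowers {N M : Subgroup G} [N.Normal] {c : G} (hc : c ^ 5 ∈ N)
    (h : M ≤ N ⊔ Subgroup.zpowers c) : N.index ∣ 5 * M.index := by
  rw [← Subgroup.relIndex_mul_index (le_sup_left : N ≤ N ⊔ Subgroup.zpowers c)]
  refine mul_dvd_mul ?_ (Subgroup.index_dvd_of_le h)
  rw [Subgroup.relIndex_sup_left, ← QuotientGroup.ker_mk' N, Subgroup.relIndex_ker,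
    MonoidHom.map_zpowers, Nat.card_zpowers]
  exact orderOf_dvd_of_pow_eq_one ((QuotientGroup.eq_one_iff _).mpr hc)

theorem index_eq_of_notMem {N M : Subgroup G} [N.Normal] {c : G} (hc : c ^ 5 ∈ N) (hcN : c ∉ N)
    (h : M ≤ N ⊔ Subgroup.zpowers c) (hNM : N ≤ M) (hcM : c ∈ M) : N.index = 5 * M.index := by
  obtain rfl : M = N ⊔ Subgroup.zpowers c :=
    le_antisymm h (sup_le hNM ((Subgroup.zpowers_le).mpr hcM))
  rw [← Subgroup.relIndex_mul_index (le_sup_left : N ≤ N ⊔ Subgroup.zpowers c)]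
  congr 1
  rw [Subgroup.relIndex_sup_left, ← QuotientGroup.ker_mk' N, Subgroup.relIndex_ker,
    MonoidHom.map_zpowers, Nat.card_zpowers]
  have : Fact (Nat.Prime 5) := ⟨by norm_num⟩
  exact orderOf_eq_prime ((QuotientGroup.eq_one_iff _).mpr hc)
    fun h1 ↦ hcN ((QuotientGroup.eq_one_iff _).mp h1)

theorem rightComm_pow_five_mem {n : ℕ} {c : G} (h₁ : c ∈ lcs G n) (h₂ : c ^ 5 ∈ lcs G (n + 1))
    (g : G) : rightComm c g ^ 5 ∈ lcs G (n + 2) := by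
  have h : Commute (c : G ⧸ lcs G (n + 2)) (rightComm (c : G ⧸ lcs G (n + 2)) g) := by
    refine (commute_of_lcs_succ (n := n + 1) (lcs_quotient_self _) ?_ _).symm
    exact rightComm_mem_lcs_left ((mk_mem_lcs_iff (by lia)).mpr h₁) _
  have h3 := rightComm_pow_left h 5
  rw [← QuotientGroup.eq_one_iff]
  refine h3.symm.trans ?_
  exact (QuotientGroup.eq_one_iff _).mpr (rightComm_mem_lcs_left h₂ g)

/-- A two-generated group whose abelianization has exponent five satisfies `(G : γ₄) ∣ 5⁵`. -/
theorem index_lcs_three_dvd (hS : Subgroup.closure {x, y} = ⊤) (hx : x ^ 5 ∈ lcs G 1)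
    (hy : y ^ 5 ∈ lcs G 1) : (lcs G 3).index ∣ 5 ^ 5 := by
  have hb := rightComm_mem_lcs_one x y
  have hb5 : rightComm x y ^ 5 ∈ lcs G 2 := rightComm_pow_five_mem (n := 0) trivial hx y
  have hc5 := fun g ↦ rightComm_pow_five_mem hb hb5 g
  have n2 : (lcs G 3 ⊔ Subgroup.zpowers (rightComm (rightComm x y) x)).Normal :=
    normal_of_lcs_le (n := 2) le_sup_left (sup_le (lcs_le (by norm_num))
      ((Subgroup.zpowers_le).mpr (rightComm_mem_lcs_left hb x)))
  have n0 : (lcs G 1 ⊔ Subgroup.zpowers x).Normal := normal_of_lcs_le (n := 0) le_sup_left le_top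
  have i1 := index_dvd_of_le_sup_zpowers (hc5 x) le_rfl
  have i2 := index_dvd_of_le_sup_zpowers (Subgroup.mem_sup_left (hc5 y)) (lcs_two_le hS)
  have i3 := index_dvd_of_le_sup_zpowers hb5 (lcs_one_le hS)
  have i4 := index_dvd_of_le_sup_zpowers hx (le_refl (lcs G 1 ⊔ Subgroup.zpowers x))
  have i5 := index_dvd_of_le_sup_zpowers (M := ⊤)
    (N := lcs G 1 ⊔ Subgroup.zpowers x) (Subgroup.mem_sup_left hy) (by
      rw [← hS, Subgroup.closure_le, Set.insert_subset_iff, Set.singleton_subset_iff]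
      exact ⟨Subgroup.mem_sup_left (Subgroup.mem_sup_right (Subgroup.mem_zpowers x)),
        Subgroup.mem_sup_right (Subgroup.mem_zpowers y)⟩)
  rw [Subgroup.index_top] at i5
  have := i1.trans (mul_dvd_mul_left 5 (i2.trans (mul_dvd_mul_left 5 (i3.trans
    (mul_dvd_mul_left 5 (i4.trans (mul_dvd_mul_left 5 i5)))))))
  norm_num at this ⊢
  exact this

/-- The index of `γ₄` when the two generators of `γ₃ / γ₄` are independent. -/
theorem index_lcs_three_eq (hS : Subgroup.closure {x, y} = ⊤) (hx : x ^ 5 ∈ lcs G 1)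
    (h₁ : rightComm (rightComm x y) x ∉ lcs G 3)
    (h₂ : ∀ i : ℤ, rightComm (rightComm x y) x ^ i * rightComm (rightComm x y) y ∉ lcs G 3) :
    (lcs G 3).index = 5 ^ 3 * (lcs G 1).index := by
  have hb := rightComm_mem_lcs_one x y
  have hb5 : rightComm x y ^ 5 ∈ lcs G 2 := rightComm_pow_five_mem (n := 0) trivial hx y
  have hc5 := fun g ↦ rightComm_pow_five_mem hb hb5 g
  have hc := fun g ↦ rightComm_mem_lcs_left hb g
  have hle : lcs G 3 ⊔ Subgroup.zpowers (rightComm (rightComm x y) x) ≤ lcs G 2 :=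
    sup_le (lcs_le (by norm_num)) ((Subgroup.zpowers_le).mpr (hc x))
  have n2 := normal_of_lcs_le (n := 2) le_sup_left hle
  have hy : rightComm (rightComm x y) y ∉
      lcs G 3 ⊔ Subgroup.zpowers (rightComm (rightComm x y) x) := by
    intro h
    obtain ⟨u, hu, v, hv, e⟩ := Subgroup.mem_sup_of_normal_left.mp h
    obtain ⟨i, rfl⟩ := Subgroup.mem_zpowers_iff.mp hv
    refine h₂ (-i) ?_
    have := (inferInstance : (lcs G 3).Normal).conj_mem u hu (rightComm (rightComm x y) x ^ (-i))
    rw [← e]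
    simpa [mul_assoc] using this
  have hbn : rightComm x y ∉ lcs G 2 := fun h ↦ h₁ (rightComm_mem_lcs_left h x)
  rw [index_eq_of_notMem (hc5 x) h₁ le_rfl le_sup_left (Subgroup.mem_sup_right
      (Subgroup.mem_zpowers _)),
    index_eq_of_notMem (Subgroup.mem_sup_left (hc5 y)) hy (lcs_two_le hS) hle (hc y),
    index_eq_of_notMem hb5 hbn (lcs_one_le hS) (lcs_le one_le_two) hb]
  ring

end Orders

/-! ### Coclass one -/

section MaximalClass

variable {G : Type*} [Group G] {x y : G}

theorem commute_of_isMetabelian (h : IsMetabelian G) {a b : G} (ha : a ∈ lcs G 1)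
    (hb : b ∈ lcs G 1) : Commute a b := by
  rw [lcs_one_eq_commutator] at ha hb
  have h1 : ⁅commutator G, commutator G⁆ = ⊥ := by
    have : derivedSeries G 2 = ⁅commutator G, commutator G⁆ := by
      rw [derivedSeries_succ, derivedSeries_one]
    rwa [← this]
  rw [← commutatorElement_eq_one_iff_commute, ← Subgroup.mem_bot, ← h1]
  exact Subgroup.commutator_mem_commutator ha hb

/-- The iterated commutator `[x, y, x, …, x]`, with `n` entries `x` after `[x, y]`. -/
def iterComm (x y : G) : ℕ → G
  | 0 => rightComm x y
  | n + 1 => rightComm (iterComm x y n) x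

theorem iterComm_mem (x y : G) (n : ℕ) : iterComm x y n ∈ lcs G (n + 1) := by
  induction n with
  | zero => exact rightComm_mem_lcs_one x y
  | succ n ih => exact rightComm_mem_lcs_left ih x

theorem iterComm_pow_five_mem (hx : x ^ 5 ∈ lcs G 1) (n : ℕ) :
    iterComm x y n ^ 5 ∈ lcs G (n + 2) := by
  induction n with
  | zero => exact rightComm_pow_five_mem (n := 0) trivial hx y
  | succ n ih => exact rightComm_pow_five_mem (iterComm_mem x y n) ih x

theorem rightComm_iterComm_mem (hm : IsMetabelian G)
    (h : rightComm (rightComm x y) y ∈ lcs G 3) (n : ℕ) :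
    rightComm (iterComm x y n) y ∈ lcs G (n + 3) := by
  induction n with
  | zero => exact h
  | succ n ih =>
    have h1 : ∀ k m, lcs G (m + 1 + k) ≤ lcs G 1 := fun k m ↦ lcs_le (by lia)
    have hc : iterComm x y n ∈ lcs G 1 := h1 0 n (iterComm_mem x y n)
    have hr : ∀ g, rightComm (iterComm x y n) g ∈ lcs G 1 := fun g ↦
      lcs_le (by norm_num) (rightComm_mem_lcs_left hc g)
    have e := rightComm_rightComm_comm (commute_of_isMetabelian hm (hr x) (hr y))
      (commute_of_isMetabelian hm (mul_mem hc (hr (y * x))) (rightComm_mem_lcs_one x y))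
    exact e ▸ rightComm_mem_lcs_left ih x

/-- Under `[x, y, y] ∈ γ₄`, each lower central factor of a metabelian group is generated by a
single iterated commutator. -/
theorem lcs_le_zpowers_iterComm (hS : Subgroup.closure {x, y} = ⊤) (hm : IsMetabelian G)
    (h : rightComm (rightComm x y) y ∈ lcs G 3) (n : ℕ) :
    lcs G (n + 1) ≤ lcs G (n + 2) ⊔ Subgroup.zpowers (iterComm x y n) := by
  induction n with
  | zero => exact lcs_one_le hS
  | succ n ih =>
    have hN : (lcs G (n + 3) ⊔ Subgroup.zpowers (iterComm x y (n + 1))).Normal :=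
      normal_of_lcs_le (n := n + 2) le_sup_left
        (sup_le (lcs_le (by lia)) ((Subgroup.zpowers_le).mpr (iterComm_mem x y (n + 1))))
    refine lcs_succ_le (n := n + 1) (T := {iterComm x y n} ∪ lcs G (n + 2)) hS ?_ ?_
    · refine ih.trans (sup_le ?_ ?_)
      · exact fun a ha ↦ Subgroup.subset_closure (Or.inr ha)
      · exact (Subgroup.zpowers_le).mpr (Subgroup.subset_closure (Or.inl rfl))
    · rintro t (rfl | ht) s hs
      · rcases hs with rfl | rfl
        · exact Subgroup.mem_sup_right (Subgroup.mem_zpowers _)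
        · exact Subgroup.mem_sup_left (rightComm_iterComm_mem hm h n)
      · exact Subgroup.mem_sup_left (rightComm_mem_lcs_left ht s)

theorem hasCoclass_one (hn : Group.IsNilpotent G) (hS : Subgroup.closure {x, y} = ⊤)
    (hm : IsMetabelian G) (hx : x ^ 5 ∈ lcs G 1) (hi : (lcs G 1).index = 5 ^ 2)
    (h : rightComm (rightComm x y) y ∈ lcs G 3) : HasCoclass 5 G 1 := by
  refine ⟨hn, ?_⟩
  set m := Group.nilpotencyClass G with hmdef
  have hbot : lcs G m = ⊥ := Subgroup.lowerCentralSeries_nilpotencyClass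
  have hne : ∀ n < m, lcs G n ≠ ⊥ := fun n hnm h0 ↦
    absurd (Subgroup.lowerCentralSeries_eq_bot_iff_nilpotencyClass_le.mp h0) (by lia)
  have key : ∀ n, n + 1 ≤ m → (lcs G (n + 1)).index = 5 ^ (n + 2) := by
    intro n
    induction n with
    | zero => exact fun _ ↦ hi
    | succ n ih =>
      intro hnm
      have hle := lcs_le_zpowers_iterComm hS hm h n
      rw [index_eq_of_notMem (iterComm_pow_five_mem hx n) ?_ hle (lcs_le (by lia))
        (iterComm_mem x y n), ih (by lia)]
      · ring
      · intro hmem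
        refine hne (n + 1) (by lia) (lcs_eq_bot_of_le_succ (hle.trans ?_))
        exact sup_le le_rfl ((Subgroup.zpowers_le).mpr hmem)
  rcases hm0 : m with _ | k
  · rw [hm0] at hbot
    have : lcs G 1 = ⊤ := top_le_iff.mp
      ((show lcs G 0 ≤ lcs G 1 by rw [hbot]; exact bot_le))
    rw [this, Subgroup.index_top] at hi
    norm_num at hi
  · rw [hm0] at hbot
    have := key k (by lia)
    rwa [hbot, Subgroup.index_bot] at this

end MaximalClass

/-! ### The groups of the family `Φ₆` -/

section Phi6

theorem lcs_three_eq_bot_of_central {G : Type*} [Group G] {x y : G}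
    (hS : Subgroup.closure {x, y} = ⊤)
    (h : ∀ s ∈ ({x, y} : Set G), ∀ t ∈ ({x, y} : Set G),
      Commute (rightComm (rightComm x y) s) t) : lcs G 3 = ⊥ := by
  have h1 : ∀ s ∈ ({x, y} : Set G),
      rightComm (rightComm x y) s ∈ Subgroup.upperCentralSeries G 1 := by
    intro s hs
    rw [Subgroup.mem_upperCentralSeries_succ_iff]
    intro g
    rw [Subgroup.upperCentralSeries_zero, Subgroup.mem_bot, commutatorElement_eq_one_iff_commute]
    exact commute_of_closure_eq_top hS (h s hs) g
  have h2 : rightComm x y ∈ Subgroup.upperCentralSeries G 2 := by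
    rw [← inv_mem_iff, Subgroup.mem_upperCentralSeries_succ_iff]
    intro g
    have := rightComm_mem_of_closure (N := Subgroup.upperCentralSeries G 1)
      (T := {rightComm x y}) (S := {x, y}) (a := rightComm x y) (g := g⁻¹)
      (by rintro t rfl; exact h1) (Subgroup.subset_closure rfl) (hS ▸ Subgroup.mem_top _)
    rwa [rightComm_eq, inv_inv] at this
  have h3 : lcs G 1 ≤ Subgroup.upperCentralSeries G 2 := by
    have e : ∀ u : G, rightComm u u = 1 := fun u ↦ rightComm_eq_one_iff.mpr (Commute.refl u)
    refine lcs_succ_le (n := 0) (T := {x, y}) hS (by rw [hS]; exact le_top) ?_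
    rintro t (rfl | rfl) s (rfl | rfl)
    exacts [(e _).symm ▸ one_mem _, h2, rightComm_inv s t ▸ inv_mem h2, (e _).symm ▸ one_mem _]
  refine le_bot_iff.mp ?_
  calc lcs G 3 = ⁅⁅lcs G 1, (⊤ : Subgroup G)⁆, (⊤ : Subgroup G)⁆ := rfl
    _ ≤ ⁅⁅Subgroup.upperCentralSeries G 2, (⊤ : Subgroup G)⁆, (⊤ : Subgroup G)⁆ :=
        Subgroup.commutator_mono (Subgroup.commutator_mono h3 le_rfl) le_rfl
    _ ≤ ⁅Subgroup.upperCentralSeries G 1, (⊤ : Subgroup G)⁆ :=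
        Subgroup.commutator_mono (Subgroup.commutator_upperCentralSeries_top_le G 1) le_rfl
    _ ≤ ⊥ := Subgroup.commutator_upperCentralSeries_top_le G 0

/-- The images of the generators `α₁, α₂, β, β₁, β₂` when `α₁ ↦ x` and `α₂ ↦ y`. -/
def phi6Images {G : Type*} [Group G] (x y : G) : Phi6Gen → G
  | .a1 => x
  | .a2 => y
  | .b => rightComm x y
  | .b1 => rightComm (rightComm x y) x
  | .b2 => rightComm (rightComm x y) y

variable {k₁₁ k₁₂ k₂₁ k₂₂ : ℕ}

/-- In class three the two power relations imply all the other relations of `Φ₆`. -/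
theorem lift_phi6Images {G : Type*} [Group G] (h : lcs G 3 = ⊥) {x y : G}
    (hx : x ^ 5 = rightComm (rightComm x y) x ^ k₁₁ * rightComm (rightComm x y) y ^ k₁₂)
    (hy : y ^ 5 = rightComm (rightComm x y) x ^ k₂₁ * rightComm (rightComm x y) y ^ k₂₂) :
    ∀ r ∈ phi6Rels k₁₁ k₁₂ k₂₁ k₂₂, FreeGroup.lift (phi6Images x y) r = 1 := by
  have hc := fun g ↦ rightComm_mem_lcs_left (rightComm_mem_lcs_one x y) g
  have hz : ∀ g u, rightComm (rightComm (rightComm x y) g) u = 1 := fun g u ↦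
    rightComm_eq_one_iff.mpr (commute_of_lcs_succ h (hc g) u)
  obtain ⟨p, p1, p2⟩ := pow_five_eq_one_of_class_three h y (x := x)
    (hx ▸ mul_mem (pow_mem (hc x) _) (pow_mem (hc y) _))
  intro r hr
  simp only [phi6Rels, Set.mem_insert_iff, Set.mem_singleton_iff] at hr
  rcases hr with rfl | rfl | rfl | rfl | rfl | rfl | rfl | rfl | rfl | rfl | rfl | rfl | rfl |
    rfl | rfl <;>
  simp only [map_mul, map_inv, map_rightComm, map_pow, FreeGroup.lift_apply_of, phi6Images, hz, p,
    p1, p2, hx, hy, mul_inv_cancel]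

/-- The homomorphism from `Φ₆` to a group of class three given by two elements that satisfy the
power relations. -/
def phi6Lift {G : Type*} [Group G] (h : lcs G 3 = ⊥) {x y : G}
    (hx : x ^ 5 = rightComm (rightComm x y) x ^ k₁₁ * rightComm (rightComm x y) y ^ k₁₂)
    (hy : y ^ 5 = rightComm (rightComm x y) x ^ k₂₁ * rightComm (rightComm x y) y ^ k₂₂) :
    Phi6Group k₁₁ k₁₂ k₂₁ k₂₂ →* G :=
  PresentedGroup.toGroup (lift_phi6Images h hx hy)

namespace Phi6Group

/-- The generator `α₁`. -/
def a1 : Phi6Group k₁₁ k₁₂ k₂₁ k₂₂ := PresentedGroup.of .a1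

/-- The generator `α₂`. -/
def a2 : Phi6Group k₁₁ k₁₂ k₂₁ k₂₂ := PresentedGroup.of .a2

theorem mk_eq_one {r : FreeGroup Phi6Gen} (h : r ∈ phi6Rels k₁₁ k₁₂ k₂₁ k₂₂) :
    PresentedGroup.mk (phi6Rels k₁₁ k₁₂ k₂₁ k₂₂) r = 1 := PresentedGroup.one_of_mem h

theorem of_b : (PresentedGroup.of .b : Phi6Group k₁₁ k₁₂ k₂₁ k₂₂) = rightComm a1 a2 := by
  have := mk_eq_one (k₁₁ := k₁₁) (k₁₂ := k₁₂) (k₂₁ := k₂₁) (k₂₂ := k₂₂)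
    (r := rightComm (.of .a1) (.of .a2) * (.of .b)⁻¹) (by simp [phi6Rels])
  rw [map_mul, map_inv, mul_inv_eq_one, map_rightComm] at this
  exact this.symm

theorem of_b1 : (PresentedGroup.of .b1 : Phi6Group k₁₁ k₁₂ k₂₁ k₂₂) =
    rightComm (rightComm a1 a2) a1 := by
  have := mk_eq_one (k₁₁ := k₁₁) (k₁₂ := k₁₂) (k₂₁ := k₂₁) (k₂₂ := k₂₂)
    (r := rightComm (.of .b) (.of .a1) * (.of .b1)⁻¹) (by simp [phi6Rels])
  rw [map_mul, map_inv, mul_inv_eq_one, map_rightComm] at this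
  rw [← of_b]
  exact this.symm

theorem of_b2 : (PresentedGroup.of .b2 : Phi6Group k₁₁ k₁₂ k₂₁ k₂₂) =
    rightComm (rightComm a1 a2) a2 := by
  have := mk_eq_one (k₁₁ := k₁₁) (k₁₂ := k₁₂) (k₂₁ := k₂₁) (k₂₂ := k₂₂)
    (r := rightComm (.of .b) (.of .a2) * (.of .b2)⁻¹) (by simp [phi6Rels])
  rw [map_mul, map_inv, mul_inv_eq_one, map_rightComm] at this
  rw [← of_b]
  exact this.symm

theorem a1_pow_five : (a1 : Phi6Group k₁₁ k₁₂ k₂₁ k₂₂) ^ 5 =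
    rightComm (rightComm a1 a2) a1 ^ k₁₁ * rightComm (rightComm a1 a2) a2 ^ k₁₂ := by
  have := mk_eq_one (k₁₁ := k₁₁) (k₁₂ := k₁₂) (k₂₁ := k₂₁) (k₂₂ := k₂₂)
    (r := .of .a1 ^ 5 * (.of .b1 ^ k₁₁ * .of .b2 ^ k₁₂)⁻¹) (by simp [phi6Rels])
  rw [map_mul, map_inv, mul_inv_eq_one, map_mul, map_pow, map_pow, map_pow] at this
  rw [← of_b1, ← of_b2]
  exact this

theorem a2_pow_five : (a2 : Phi6Group k₁₁ k₁₂ k₂₁ k₂₂) ^ 5 =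
    rightComm (rightComm a1 a2) a1 ^ k₂₁ * rightComm (rightComm a1 a2) a2 ^ k₂₂ := by
  have := mk_eq_one (k₁₁ := k₁₁) (k₁₂ := k₁₂) (k₂₁ := k₂₁) (k₂₂ := k₂₂)
    (r := .of .a2 ^ 5 * (.of .b1 ^ k₂₁ * .of .b2 ^ k₂₂)⁻¹) (by simp [phi6Rels])
  rw [map_mul, map_inv, mul_inv_eq_one, map_mul, map_pow, map_pow, map_pow] at this
  rw [← of_b1, ← of_b2]
  exact this

theorem closure_eq_top :
    Subgroup.closure {a1, a2} = (⊤ : Subgroup (Phi6Group k₁₁ k₁₂ k₂₁ k₂₂)) := by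
  have h1 : a1 ∈ Subgroup.closure {a1, (a2 : Phi6Group k₁₁ k₁₂ k₂₁ k₂₂)} :=
    Subgroup.subset_closure (by simp)
  have h2 : a2 ∈ Subgroup.closure {a1, (a2 : Phi6Group k₁₁ k₁₂ k₂₁ k₂₂)} :=
    Subgroup.subset_closure (by simp)
  have hc : ∀ {u v : Phi6Group k₁₁ k₁₂ k₂₁ k₂₂} {H : Subgroup (Phi6Group k₁₁ k₁₂ k₂₁ k₂₂)},
      u ∈ H → v ∈ H → rightComm u v ∈ H := fun hu hv ↦
    mul_mem (mul_mem (mul_mem (inv_mem hu) (inv_mem hv)) hu) hv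
  rw [← top_le_iff, ← PresentedGroup.closure_range_of, Subgroup.closure_le]
  rintro _ ⟨g, rfl⟩
  cases g
  · exact h1
  · exact h2
  · exact of_b ▸ hc h1 h2
  · exact of_b1 ▸ hc (hc h1 h2) h1
  · exact of_b2 ▸ hc (hc h1 h2) h2

theorem lcs_three : lcs (Phi6Group k₁₁ k₁₂ k₂₁ k₂₂) 3 = ⊥ := by
  have key : ∀ {u v : Phi6Gen}, rightComm (.of u) (.of v) ∈ phi6Rels k₁₁ k₁₂ k₂₁ k₂₂ →
      Commute (PresentedGroup.of u : Phi6Group k₁₁ k₁₂ k₂₁ k₂₂) (PresentedGroup.of v) := by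
    intro u v h
    have := mk_eq_one h
    rwa [map_rightComm, rightComm_eq_one_iff] at this
  refine lcs_three_eq_bot_of_central closure_eq_top ?_
  rintro s (rfl | rfl) t (rfl | rfl)
  · rw [← of_b1]; exact key (by simp [phi6Rels])
  · rw [← of_b1]; exact key (by simp [phi6Rels])
  · rw [← of_b2]; exact key (by simp [phi6Rels])
  · rw [← of_b2]; exact key (by simp [phi6Rels])

@[simp]
theorem phi6Lift_a1 {G : Type*} [Group G] (h : lcs G 3 = ⊥) {x y : G}
    (hx : x ^ 5 = rightComm (rightComm x y) x ^ k₁₁ * rightComm (rightComm x y) y ^ k₁₂)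
    (hy : y ^ 5 = rightComm (rightComm x y) x ^ k₂₁ * rightComm (rightComm x y) y ^ k₂₂) :
    phi6Lift h hx hy a1 = x := PresentedGroup.toGroup.of _

@[simp]
theorem phi6Lift_a2 {G : Type*} [Group G] (h : lcs G 3 = ⊥) {x y : G}
    (hx : x ^ 5 = rightComm (rightComm x y) x ^ k₁₁ * rightComm (rightComm x y) y ^ k₁₂)
    (hy : y ^ 5 = rightComm (rightComm x y) x ^ k₂₁ * rightComm (rightComm x y) y ^ k₂₂) :
    phi6Lift h hx hy a2 = y := PresentedGroup.toGroup.of _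

theorem hom_ext {G : Type*} [Group G] {f g : Phi6Group k₁₁ k₁₂ k₂₁ k₂₂ →* G} (h1 : f a1 = g a1)
    (h2 : f a2 = g a2) : f = g := by
  refine MonoidHom.eq_of_eqOn_dense closure_eq_top ?_
  rintro _ (rfl | rfl)
  exacts [h1, h2]

theorem a1_pow_five_mem : (a1 : Phi6Group k₁₁ k₁₂ k₂₁ k₂₂) ^ 5 ∈ lcs _ 2 := by
  have hc := fun g ↦ rightComm_mem_lcs_left
    (rightComm_mem_lcs_one (a1 : Phi6Group k₁₁ k₁₂ k₂₁ k₂₂) a2) g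
  rw [a1_pow_five]
  exact mul_mem (pow_mem (hc _) _) (pow_mem (hc _) _)

theorem a2_pow_five_mem : (a2 : Phi6Group k₁₁ k₁₂ k₂₁ k₂₂) ^ 5 ∈ lcs _ 2 := by
  have hc := fun g ↦ rightComm_mem_lcs_left
    (rightComm_mem_lcs_one (a1 : Phi6Group k₁₁ k₁₂ k₂₁ k₂₂) a2) g
  rw [a2_pow_five]
  exact mul_mem (pow_mem (hc _) _) (pow_mem (hc _) _)

theorem card_dvd : Nat.card (Phi6Group k₁₁ k₁₂ k₂₁ k₂₂) ∣ 5 ^ 5 := by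
  have := index_lcs_three_dvd closure_eq_top (lcs_le one_le_two a1_pow_five_mem)
    (lcs_le one_le_two (a2_pow_five_mem (k₁₁ := k₁₁) (k₁₂ := k₁₂) (k₂₁ := k₂₁) (k₂₂ := k₂₂)))
  rwa [lcs_three, Subgroup.index_bot] at this

instance : Finite (Phi6Group k₁₁ k₁₂ k₂₁ k₂₂) :=
  Nat.finite_of_card_ne_zero fun h ↦ by
    have := card_dvd (k₁₁ := k₁₁) (k₁₂ := k₁₂) (k₂₁ := k₂₁) (k₂₂ := k₂₂)
    rw [h] at this
    norm_num at this

theorem isPGroup : IsPGroup 5 (Phi6Group k₁₁ k₁₂ k₂₁ k₂₂) := by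
  obtain ⟨m, -, hm⟩ := (Nat.dvd_prime_pow (by norm_num)).mp
    (card_dvd (k₁₁ := k₁₁) (k₁₂ := k₁₂) (k₂₁ := k₂₁) (k₂₂ := k₂₂))
  exact IsPGroup.of_card hm

end Phi6Group

end Phi6

/-! ### Schur `σ`-groups -/

section SchurSigma

namespace Phi6Group

variable {k₁₁ k₁₂ k₂₁ k₂₂ : ℕ}

theorem rightComm_rightComm_inv {G : Type*} [Group G] (h : lcs G 3 = ⊥) (x y z : G) :
    rightComm (rightComm x⁻¹ y⁻¹) z⁻¹ = (rightComm (rightComm x y) z)⁻¹ := by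
  have := rightComm_rightComm_of_class_three h x y z (-1) (-1) (-1) (one_mem _) (one_mem _)
    (one_mem _)
  simpa using this

theorem inv_pow_five {G : Type*} [Group G] (h : lcs G 3 = ⊥) {x y u : G} {k l : ℕ}
    (hu : u ^ 5 = rightComm (rightComm x y) x ^ k * rightComm (rightComm x y) y ^ l) :
    u⁻¹ ^ 5 = rightComm (rightComm x⁻¹ y⁻¹) x⁻¹ ^ k * rightComm (rightComm x⁻¹ y⁻¹) y⁻¹ ^ l := by
  have hc := commute_of_lcs_succ h (rightComm_mem_lcs_left (rightComm_mem_lcs_one x y) x)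
    (rightComm (rightComm x y) y)
  rw [rightComm_rightComm_inv h, rightComm_rightComm_inv h, inv_pow, hu, inv_pow, inv_pow,
    ← mul_inv_rev, (hc.pow_pow k l).eq]

variable (k₁₁ k₁₂ k₂₁ k₂₂) in
/-- The endomorphism of `Φ₆` that inverts the generators `α₁` and `α₂`. -/
def inversion : Phi6Group k₁₁ k₁₂ k₂₁ k₂₂ →* Phi6Group k₁₁ k₁₂ k₂₁ k₂₂ :=
  phi6Lift lcs_three (x := a1⁻¹) (y := a2⁻¹) (inv_pow_five lcs_three a1_pow_five)
    (inv_pow_five lcs_three a2_pow_five)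

theorem inversion_a1 : inversion k₁₁ k₁₂ k₂₁ k₂₂ a1 = a1⁻¹ := phi6Lift_a1 _ _ _

theorem inversion_a2 : inversion k₁₁ k₁₂ k₂₁ k₂₂ a2 = a2⁻¹ := phi6Lift_a2 _ _ _

theorem inversion_comp_inversion :
    (inversion k₁₁ k₁₂ k₂₁ k₂₂).comp (inversion k₁₁ k₁₂ k₂₁ k₂₂) = MonoidHom.id _ := by
  refine hom_ext ?_ ?_ <;> simp [inversion_a1, inversion_a2]

theorem a1_sq_ne_one : (a1 : Phi6Group k₁₁ k₁₂ k₂₁ k₂₂) ^ 2 ≠ 1 := by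
  intro h
  have e : ∀ u v : Multiplicative (ZMod 5), rightComm u v = 1 := fun u v ↦
    rightComm_eq_one_iff.mpr (Commute.all u v)
  have h5 : ∀ u : Multiplicative (ZMod 5), u ^ 5 = 1 := by decide
  have hl : lcs (Multiplicative (ZMod 5)) 3 = ⊥ := by
    refine le_bot_iff.mp ((lcs_le (by norm_num : 1 ≤ 3)).trans ?_)
    exact Subgroup.commutator_le.mpr fun a _ b _ ↦ by
      rw [Subgroup.mem_bot, commutatorElement_eq_one_iff_mul_comm, mul_comm]
  let f : Phi6Group k₁₁ k₁₂ k₂₁ k₂₂ →* Multiplicative (ZMod 5) :=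
    phi6Lift hl (x := Multiplicative.ofAdd 1) (y := 1) (by simp [e, h5]) (by simp [e])
  have h1 : f a1 = Multiplicative.ofAdd 1 := phi6Lift_a1 _ _ _
  have h2 := congrArg f h
  rw [map_pow, h1, f.map_one] at h2
  exact absurd h2 (by decide)

theorem isSigmaGroup_two : IsSigmaGroup 2 (Phi6Group k₁₁ k₁₂ k₂₁ k₂₂) := by
  let σ : MulAut (Phi6Group k₁₁ k₁₂ k₂₁ k₂₂) :=
    (inversion k₁₁ k₁₂ k₂₁ k₂₂).toMulEquiv (inversion k₁₁ k₁₂ k₂₁ k₂₂)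
      inversion_comp_inversion inversion_comp_inversion
  have hσ : ∀ g, σ g = inversion k₁₁ k₁₂ k₂₁ k₂₂ g := fun _ ↦ rfl
  have : Fact (Nat.Prime 2) := ⟨Nat.prime_two⟩
  refine ⟨σ, orderOf_eq_prime ?_ ?_, fun g ↦ ?_⟩
  · ext g
    rw [sq, MulAut.mul_apply, hσ, hσ]
    exact DFunLike.congr_fun inversion_comp_inversion g
  · intro h
    have h1 : σ a1 = a1 := by rw [h]; rfl
    rw [hσ, inversion_a1, inv_eq_iff_mul_eq_one, ← sq] at h1
    exact a1_sq_ne_one h1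
  · have h1 : Abelianization.of * Abelianization.of.comp (inversion k₁₁ k₁₂ k₂₁ k₂₂) = 1 :=
      hom_ext (by simp [inversion_a1]) (by simp [inversion_a2])
    have h2 := DFunLike.congr_fun h1 g
    rw [← Abelianization.ker_of, MonoidHom.mem_ker]
    simpa [List.range_succ, hσ] using h2

/-- The balanced presentation with generators `x, y` and relators `x⁵ = [x, y, x]ᵏ`,
`y⁵ = [x, y, y]`. -/
theorem hasProPPresentation {k : ℕ} (hk : ¬ 5 ∣ k) (hk' : ¬ 5 ∣ k + 1) :
    HasProPPresentation 5 (Phi6Group k 0 0 1) 2 2 := by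
  let φ : FreeGroup (Fin 2) →* Phi6Group k 0 0 1 := FreeGroup.lift ![a1, a2]
  let x : FreeGroup (Fin 2) := FreeGroup.of 0
  let y : FreeGroup (Fin 2) := FreeGroup.of 1
  have hφx : φ x = a1 := by simp [φ, x]
  have hφy : φ y = a2 := by simp [φ, y]
  have hxy : Subgroup.closure {x, y} = ⊤ := by
    rw [← FreeGroup.closure_range_of]
    congr 1
    ext g
    simp [x, y, Fin.exists_fin_two, eq_comm]
  refine ⟨φ, ![x ^ 5 * (rightComm (rightComm x y) x ^ k)⁻¹,
    y ^ 5 * (rightComm (rightComm x y) y)⁻¹], ?_, ?_, ?_⟩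
  · rw [← MonoidHom.range_eq_top, ← top_le_iff, ← closure_eq_top, Subgroup.closure_le]
    rintro _ (rfl | rfl)
    exacts [⟨x, hφx⟩, ⟨y, hφy⟩]
  · have h1 := a1_pow_five (k₁₁ := k) (k₁₂ := 0) (k₂₁ := 0) (k₂₂ := 1)
    have h2 := a2_pow_five (k₁₁ := k) (k₁₂ := 0) (k₂₁ := 0) (k₂₂ := 1)
    rw [pow_zero, mul_one] at h1
    rw [pow_zero, pow_one, one_mul] at h2
    simp [Fin.forall_fin_two, map_rightComm, hφx, hφy, h1, h2]
  · intro H _ _ hH ψ hψ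
    have : Fact (Nat.Prime 5) := ⟨by norm_num⟩
    have hn : Group.IsNilpotent ψ.range := (hH.to_subgroup ψ.range).isNilpotent
    have hψ' : ∀ r, ψ r = 1 → ψ.rangeRestrict r = 1 := fun r hr ↦ Subtype.ext hr
    have hx := hψ' _ (hψ 0)
    have hy := hψ' _ (hψ 1)
    simp only [Matrix.cons_val_zero, Matrix.cons_val_one, map_mul, map_inv, mul_inv_eq_one,
      map_pow, map_rightComm] at hx hy
    have hS : Subgroup.closure {ψ.rangeRestrict x, ψ.rangeRestrict y} = ⊤ := by
      rw [← Set.image_pair, ← MonoidHom.map_closure, hxy,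
        Subgroup.map_top_of_surjective _ ψ.rangeRestrict_surjective]
    have hl : lcs ψ.range 3 = ⊥ := lcs_three_eq_bot hS (a := k) (b := 1) (by exact_mod_cast hk)
      (by norm_num) (by exact_mod_cast hk') (one_mem _) (one_mem _) (by simpa using hx)
      (by simpa using hy)
    let f : Phi6Group k 0 0 1 →* ψ.range := phi6Lift hl (by simpa using hx) (by simpa using hy)
    have hf : f.comp φ = ψ.rangeRestrict := by
      refine MonoidHom.eq_of_eqOn_dense hxy ?_
      rintro _ (rfl | rfl)
      · rw [MonoidHom.comp_apply, hφx, phi6Lift_a1]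
      · rw [MonoidHom.comp_apply, hφy, phi6Lift_a2]
    intro r hr
    rw [← MonoidHom.ker_rangeRestrict, ← hf, MonoidHom.mem_ker, MonoidHom.comp_apply,
      MonoidHom.mem_ker.mp hr, map_one]

theorem isSchurSigmaGroup {k : ℕ} (hk : ¬ 5 ∣ k) (hk' : ¬ 5 ∣ k + 1) :
    IsSchurSigmaGroup 5 (Phi6Group k 0 0 1) :=
  ⟨inferInstance, isPGroup, isSigmaGroup_two, 2, hasProPPresentation hk hk'⟩

end Phi6Group

end SchurSigma

/-! ### Capability -/

section Capability

variable {k₁₁ k₁₂ k₂₁ k₂₂ : ℕ}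

theorem lcs_four_eq_bot {G : Type*} [Group G] [Group.IsNilpotent G] {x y : G}
    (hS : Subgroup.closure {x, y} = ⊤)
    (h : ∀ s ∈ ({x, y} : Set G), ∀ t ∈ ({x, y} : Set G), ∀ u ∈ ({x, y} : Set G),
      Commute (rightComm (rightComm (rightComm x y) s) t) u) : lcs G 4 = ⊥ := by
  refine lcs_eq_bot_of_le_succ ?_
  refine lcs_succ_le (n := 3) (T := Subgroup.center G ∪ lcs G 4) hS ?_ ?_
  · rw [← Subgroup.sup_eq_closure]
    refine lcs_three_le hS le_sup_right fun s hs t ht ↦ Subgroup.mem_sup_left ?_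
    exact Subgroup.mem_center_iff.mpr fun g ↦
      (commute_of_closure_eq_top hS (h s hs t ht) g).eq.symm
  · rintro t (ht | ht) s hs
    · rw [rightComm_eq_one_iff.mpr (Subgroup.mem_center_iff.mp ht s).symm]
      exact one_mem _
    · exact rightComm_mem_lcs_left ht s

theorem map_power_relation {G H : Type*} [Group G] [Group H] (π : G →* H) {x y u d : G}
    {k l e : ℕ} (hu : u = rightComm (rightComm x y) x ^ k * rightComm (rightComm x y) y ^ l * d ^ e)
    (hd : π d = 1) : π u = rightComm (rightComm (π x) (π y)) (π x) ^ k *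
      rightComm (rightComm (π x) (π y)) (π y) ^ l := by
  simp [hu, hd, map_rightComm]

/-- The class-four cover. If `x`, `y` in a finite `5`-group `K` satisfy the power relations
of `Φ₆` up to fourfold commutators, and these fourfold commutators are central but not all trivial,
then they lift the generators `u`, `v` of a group `Q` of class three satisfying the same power
relations to generators of a subgroup of `K × Q` of class exactly four. -/
theorem exists_class_four_cover {K Q : Type} [Group K] [Finite K] [Group Q] [Finite Q]
    (hK : IsPGroup 5 K) (hQ : IsPGroup 5 Q) (hQ3 : lcs Q 3 = ⊥) {x y : K} {u v : Q} {e f : ℕ}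
    (hx : x ^ 5 = rightComm (rightComm x y) x ^ k₁₁ * rightComm (rightComm x y) y ^ k₁₂ *
      rightComm (rightComm (rightComm x y) x) y ^ e)
    (hy : y ^ 5 = rightComm (rightComm x y) x ^ k₂₁ * rightComm (rightComm x y) y ^ k₂₂ *
      rightComm (rightComm (rightComm x y) x) y ^ f)
    (hu : u ^ 5 = rightComm (rightComm u v) u ^ k₁₁ * rightComm (rightComm u v) v ^ k₁₂)
    (hv : v ^ 5 = rightComm (rightComm u v) u ^ k₂₁ * rightComm (rightComm u v) v ^ k₂₂)
    (hcen : ∀ s ∈ ({x, y} : Set K), ∀ t ∈ ({x, y} : Set K), ∀ r ∈ ({x, y} : Set K),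
      rightComm (rightComm (rightComm (rightComm x y) s) t) r = 1)
    (hne : ∃ s ∈ ({x, y} : Set K), ∃ t ∈ ({x, y} : Set K),
      rightComm (rightComm (rightComm x y) s) t ≠ 1) :
    ∃ (H : Subgroup (K × Q)) (X Y : H) (q : H →* Q), IsPGroup 5 H ∧ lcs H 3 ≠ ⊥ ∧ lcs H 4 = ⊥ ∧
      Subgroup.closure {X, Y} = ⊤ ∧ q X = u ∧ q Y = v ∧
      X ^ 5 = rightComm (rightComm X Y) X ^ k₁₁ * rightComm (rightComm X Y) Y ^ k₁₂ *
        rightComm (rightComm (rightComm X Y) X) Y ^ e ∧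
      Y ^ 5 = rightComm (rightComm X Y) X ^ k₂₁ * rightComm (rightComm X Y) Y ^ k₂₂ *
        rightComm (rightComm (rightComm X Y) X) Y ^ f := by
  have : Fact (Nat.Prime 5) := ⟨by norm_num⟩
  let H : Subgroup (K × Q) := Subgroup.closure {(x, u), (y, v)}
  let X : H := ⟨(x, u), Subgroup.subset_closure (by simp)⟩
  let Y : H := ⟨(y, v), Subgroup.subset_closure (by simp)⟩
  let p : H →* K := (MonoidHom.fst K Q).comp H.subtype
  let q : H →* Q := (MonoidHom.snd K Q).comp H.subtype
  have hpX : p X = x := rfl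
  have hpY : p Y = y := rfl
  have hqX : q X = u := rfl
  have hqY : q Y = v := rfl
  have hext : ∀ g h : H, p g = p h → q g = q h → g = h := fun g h h1 h2 ↦
    Subtype.ext (Prod.ext h1 h2)
  have hS : Subgroup.closure {X, Y} = ⊤ := by
    refine Subgroup.map_injective H.subtype_injective ?_
    rw [MonoidHom.map_closure, Set.image_pair, ← MonoidHom.range_eq_map, H.range_subtype]
    rfl
  have hP : IsPGroup 5 H := by
    have h1 : IsPGroup 5 (K × Q) := by
      obtain ⟨m, hm⟩ := IsPGroup.iff_card.mp hK
      obtain ⟨n, hn⟩ := IsPGroup.iff_card.mp hQ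
      exact IsPGroup.of_card (n := m + n) (by rw [Nat.card_prod, hm, hn, pow_add])
    exact h1.to_subgroup H
  have hnil : Group.IsNilpotent H := hP.isNilpotent
  have hmem := fun s t ↦ rightComm_mem_lcs_left
    (rightComm_mem_lcs_left (rightComm_mem_lcs_one X Y) s) t
  have hq1 : ∀ s ∈ lcs H 3, q s = 1 := fun s hs ↦ by
    rw [← Subgroup.mem_bot, ← hQ3]
    exact map_mem_lcs q hs
  refine ⟨H, X, Y, q, hP, ?_, ?_, hS, hqX, hqY, ?_, ?_⟩
  · intro h0
    obtain ⟨s, hs, t, ht, hst⟩ := hne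
    have hp : ∀ s ∈ ({x, y} : Set K), ∃ s', p s' = s := by
      rintro s (rfl | rfl)
      exacts [⟨X, hpX⟩, ⟨Y, hpY⟩]
    obtain ⟨s', rfl⟩ := hp s hs
    obtain ⟨t', rfl⟩ := hp t ht
    have h1 := hmem s' t'
    rw [h0, Subgroup.mem_bot] at h1
    refine hst ?_
    rw [← hpX, ← hpY, ← map_rightComm, ← map_rightComm, ← map_rightComm, h1, map_one]
  · refine lcs_four_eq_bot hS fun s hs t ht r hr ↦ rightComm_eq_one_iff.mp ?_
    have hp : ∀ s ∈ ({X, Y} : Set H), p s ∈ ({x, y} : Set K) := by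
      rintro s (rfl | rfl)
      exacts [Or.inl hpX, Or.inr hpY]
    refine hext _ _ ?_ ?_
    · simp only [map_rightComm, hpX, hpY, map_one]
      exact hcen _ (hp s hs) _ (hp t ht) _ (hp r hr)
    · rw [hq1 _ (lcs_le (by norm_num) (rightComm_mem_lcs_left (hmem s t) r)), map_one]
  · refine hext _ _ ?_ ?_
    · simp only [map_mul, map_pow, map_rightComm, hpX, hpY, hx]
    · rw [map_power_relation q rfl (hq1 _ (hmem X Y)), map_pow, hqX, hqY, hu]
  · refine hext _ _ ?_ ?_
    · simp only [map_mul, map_pow, map_rightComm, hpX, hpY, hy]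
    · rw [map_power_relation q rfl (hq1 _ (hmem X Y)), map_pow, hqX, hqY, hv]

/-- A criterion for capability: the class-four cover attached to `K` is an immediate descendant
of `Φ₆`. -/
theorem isCapable_of_model {K : Type} [Group K] [Finite K] (hK : IsPGroup 5 K) {x y : K} {e f : ℕ}
    (hx : x ^ 5 = rightComm (rightComm x y) x ^ k₁₁ * rightComm (rightComm x y) y ^ k₁₂ *
      rightComm (rightComm (rightComm x y) x) y ^ e)
    (hy : y ^ 5 = rightComm (rightComm x y) x ^ k₂₁ * rightComm (rightComm x y) y ^ k₂₂ *
      rightComm (rightComm (rightComm x y) x) y ^ f)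
    (hcen : ∀ s ∈ ({x, y} : Set K), ∀ t ∈ ({x, y} : Set K), ∀ r ∈ ({x, y} : Set K),
      rightComm (rightComm (rightComm (rightComm x y) s) t) r = 1)
    (hne : ∃ s ∈ ({x, y} : Set K), ∃ t ∈ ({x, y} : Set K),
      rightComm (rightComm (rightComm x y) s) t ≠ 1) :
    IsCapable 5 (Phi6Group k₁₁ k₁₂ k₂₁ k₂₂) := by
  obtain ⟨H, X, Y, q, hP, hl3, hl4, hS, hqX, hqY, hX, hY⟩ := exists_class_four_cover hK
    Phi6Group.isPGroup Phi6Group.lcs_three hx hy Phi6Group.a1_pow_five Phi6Group.a2_pow_five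
    hcen hne
  -- `H / γ₄(H)` and `Φ₆` map onto each other, compatibly with the generators.
  have hq1 : ∀ s ∈ lcs H 3, q s = 1 := fun s hs ↦ by
    rw [← Subgroup.mem_bot, ← Phi6Group.lcs_three]
    exact map_mem_lcs q hs
  have hπ : QuotientGroup.mk' (lcs H 3) (rightComm (rightComm (rightComm X Y) X) Y) = 1 :=
    (QuotientGroup.eq_one_iff _).mpr (rightComm_mem_lcs_left
      (rightComm_mem_lcs_left (rightComm_mem_lcs_one X Y) X) Y)
  have eX := map_power_relation (QuotientGroup.mk' (lcs H 3)) hX hπ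
  have eY := map_power_relation (QuotientGroup.mk' (lcs H 3)) hY hπ
  rw [map_pow] at eX eY
  let F := phi6Lift (lcs_quotient_self 3) eX eY
  let F' : H ⧸ lcs H 3 →* Phi6Group k₁₁ k₁₂ k₂₁ k₂₂ := QuotientGroup.lift (lcs H 3) q hq1
  refine ⟨H, inferInstance, inferInstance, hP, 3, hl3, hl4, ⟨F'.toMulEquiv F ?_ ?_⟩⟩
  · refine QuotientGroup.monoidHom_ext _ (MonoidHom.eq_of_eqOn_dense hS ?_)
    rintro _ (rfl | rfl)
    · exact (congrArg F hqX).trans (Phi6Group.phi6Lift_a1 (lcs_quotient_self 3) eX eY)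
    · exact (congrArg F hqY).trans (Phi6Group.phi6Lift_a2 (lcs_quotient_self 3) eX eY)
  · refine Phi6Group.hom_ext ?_ ?_
    · exact (congrArg F' (Phi6Group.phi6Lift_a1 (lcs_quotient_self 3) eX eY)).trans hqX
    · exact (congrArg F' (Phi6Group.phi6Lift_a2 (lcs_quotient_self 3) eX eY)).trans hqY

/-- The semidirect product of the polynomials `a + b X + c X² + d X³` over `𝔽₅` by the translations
`X ↦ X + n`, a group of maximal class; the product is `(n, f) (m, g) = (n + m, f(X + m) + g)`. -/
@[ext]
structure TranslationGroup where
  /-- the translation -/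
  n : ZMod 5
  /-- the constant coefficient -/
  a : ZMod 5
  /-- the linear coefficient -/
  b : ZMod 5
  /-- the quadratic coefficient -/
  c : ZMod 5
  /-- the cubic coefficient -/
  d : ZMod 5

namespace TranslationGroup

instance : Mul TranslationGroup where
  mul u v :=
    { n := u.n + v.n
      a := u.a + u.b * v.n + u.c * v.n ^ 2 + u.d * v.n ^ 3 + v.a
      b := u.b + 2 * u.c * v.n + 3 * u.d * v.n ^ 2 + v.b
      c := u.c + 3 * u.d * v.n + v.c
      d := u.d + v.d }

instance : One TranslationGroup := ⟨⟨0, 0, 0, 0, 0⟩⟩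

instance : Inv TranslationGroup where
  inv u :=
    { n := -u.n
      a := -(u.a - u.b * u.n + u.c * u.n ^ 2 - u.d * u.n ^ 3)
      b := -(u.b - 2 * u.c * u.n + 3 * u.d * u.n ^ 2)
      c := -(u.c - 3 * u.d * u.n)
      d := -u.d }

theorem mul_def (u v : TranslationGroup) : u * v =
    { n := u.n + v.n
      a := u.a + u.b * v.n + u.c * v.n ^ 2 + u.d * v.n ^ 3 + v.a
      b := u.b + 2 * u.c * v.n + 3 * u.d * v.n ^ 2 + v.b
      c := u.c + 3 * u.d * v.n + v.c
      d := u.d + v.d } := rfl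

theorem one_def : (1 : TranslationGroup) = ⟨0, 0, 0, 0, 0⟩ := rfl

theorem inv_def (u : TranslationGroup) : u⁻¹ =
    { n := -u.n
      a := -(u.a - u.b * u.n + u.c * u.n ^ 2 - u.d * u.n ^ 3)
      b := -(u.b - 2 * u.c * u.n + 3 * u.d * u.n ^ 2)
      c := -(u.c - 3 * u.d * u.n)
      d := -u.d } := rfl

instance : Group TranslationGroup :=
  Group.ofLeftAxioms
    (fun u v w ↦ by ext <;> simp only [mul_def] <;> ring)
    (fun u ↦ by ext <;> simp only [mul_def, one_def] <;> ring)
    (fun u ↦ by ext <;> simp only [mul_def, one_def, inv_def] <;> ring)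

/-- The coordinates as an equivalence. -/
def equivProd : TranslationGroup ≃ ZMod 5 × ZMod 5 × ZMod 5 × ZMod 5 × ZMod 5 where
  toFun u := (u.n, u.a, u.b, u.c, u.d)
  invFun t := ⟨t.1, t.2.1, t.2.2.1, t.2.2.2.1, t.2.2.2.2⟩
  left_inv _ := rfl
  right_inv _ := rfl

instance : Finite TranslationGroup := Finite.of_equiv _ equivProd.symm

instance : DecidableEq TranslationGroup := equivProd.decidableEq

theorem isPGroup : IsPGroup 5 TranslationGroup :=
  IsPGroup.of_card (n := 5) (by rw [Nat.card_congr equivProd]; simp)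

end TranslationGroup

/-- The cubic `X³` and the translation `X ↦ X + 1` show that `Φ₆` is capable when `α₁⁵` and `α₂⁵`
are powers of `β₁`. -/
theorem isCapable_phi6Group (k l : ℕ) : IsCapable 5 (Phi6Group k 0 l 0) := by
  let x : TranslationGroup := ⟨0, 0, 0, 0, 1⟩
  let y : TranslationGroup := ⟨1, 0, 0, 0, 0⟩
  have h1 : rightComm (rightComm x y) x = 1 := by decide
  have h2 : ∀ g : TranslationGroup, rightComm 1 g = 1 := fun g ↦
    rightComm_eq_one_iff.mpr (Commute.one_left g)
  have h3 : rightComm (rightComm (rightComm x y) y) x = 1 := by decide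
  have h4 : rightComm (rightComm (rightComm (rightComm x y) y) y) x = 1 := by decide
  have h5 : rightComm (rightComm (rightComm (rightComm x y) y) y) y = 1 := by decide
  refine isCapable_of_model TranslationGroup.isPGroup (x := x) (y := y) (e := 0) (f := 0)
    ?_ ?_ ?_ ⟨y, by simp, y, by simp, by decide⟩
  · rw [h1, one_pow]; decide
  · rw [h1, one_pow]; decide
  · rintro s (rfl | rfl) t (rfl | rfl) u (rfl | rfl) <;> simp only [h1, h2, h3, h4, h5]

/-- The quotient `(1 + J) / (1 + J⁵)`, where `J` is the Jacobson radical of the order of `2 × 2`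
matrices over `ℤ₅` that are lower triangular modulo `5`. The quadruple `(a, b, c, d)` stands for the
matrix with rows `(1 + 5 a, 5 b)` and `(c, 1 + 5 d)`; all four entries are determined modulo `25`
because `J⁵ = 25 J`. -/
@[ext]
structure IwahoriGroup where
  /-- the entry `1 + 5 a` -/
  a : ZMod 25
  /-- the entry `5 b` -/
  b : ZMod 25
  /-- the entry `c` -/
  c : ZMod 25
  /-- the entry `1 + 5 d` -/
  d : ZMod 25

namespace IwahoriGroup

/-- The determinant is `1 + 5 e` with this value `e`. -/
def e (u : IwahoriGroup) : ZMod 25 := u.a + u.d + 5 * u.a * u.d - u.b * u.c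

instance : Mul IwahoriGroup where
  mul u v :=
    { a := u.a + v.a + 5 * u.a * v.a + u.b * v.c
      b := u.b + v.b + 5 * u.a * v.b + 5 * u.b * v.d
      c := u.c + v.c + 5 * u.c * v.a + 5 * u.d * v.c
      d := u.d + v.d + 5 * u.d * v.d + u.c * v.b }

instance : One IwahoriGroup := ⟨⟨0, 0, 0, 0⟩⟩

-- The adjugate divided by `1 + 5 e`, whose inverse modulo `25` is `1 - 5 e`.
instance : Inv IwahoriGroup where
  inv u :=
    { a := (u.d - u.e) * (1 - 5 * u.e)
      b := -u.b * (1 - 5 * u.e)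
      c := -u.c * (1 - 5 * u.e)
      d := (u.a - u.e) * (1 - 5 * u.e) }

theorem mul_def (u v : IwahoriGroup) : u * v =
    { a := u.a + v.a + 5 * u.a * v.a + u.b * v.c
      b := u.b + v.b + 5 * u.a * v.b + 5 * u.b * v.d
      c := u.c + v.c + 5 * u.c * v.a + 5 * u.d * v.c
      d := u.d + v.d + 5 * u.d * v.d + u.c * v.b } := rfl

theorem one_def : (1 : IwahoriGroup) = ⟨0, 0, 0, 0⟩ := rfl

theorem inv_def (u : IwahoriGroup) : u⁻¹ =
    { a := (u.d - u.e) * (1 - 5 * u.e)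
      b := -u.b * (1 - 5 * u.e)
      c := -u.c * (1 - 5 * u.e)
      d := (u.a - u.e) * (1 - 5 * u.e) } := rfl

theorem inv_mul_self (u : IwahoriGroup) : u⁻¹ * u = 1 := by
  have h : (25 : ZMod 25) = 0 := by decide
  ext <;> simp only [mul_def, one_def, inv_def, e]
  · linear_combination u.a * (u.a + u.d + 5 * u.a * u.d - u.b * u.c) ^ 2 * h
  · linear_combination u.b * (u.a + u.d + 5 * u.a * u.d - u.b * u.c) ^ 2 * h
  · linear_combination u.c * (u.a + u.d + 5 * u.a * u.d - u.b * u.c) ^ 2 * h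
  · linear_combination u.d * (u.a + u.d + 5 * u.a * u.d - u.b * u.c) ^ 2 * h

instance : Group IwahoriGroup :=
  Group.ofLeftAxioms
    (fun u v w ↦ by ext <;> simp only [mul_def] <;> ring)
    (fun u ↦ by ext <;> simp only [mul_def, one_def] <;> ring)
    inv_mul_self

/-- The coordinates as an equivalence. -/
def equivProd : IwahoriGroup ≃ ZMod 25 × ZMod 25 × ZMod 25 × ZMod 25 where
  toFun u := (u.a, u.b, u.c, u.d)
  invFun t := ⟨t.1, t.2.1, t.2.2.1, t.2.2.2⟩
  left_inv _ := rfl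
  right_inv _ := rfl

instance : Finite IwahoriGroup := Finite.of_equiv _ equivProd.symm

instance : DecidableEq IwahoriGroup := equivProd.decidableEq

theorem isPGroup : IsPGroup 5 IwahoriGroup :=
  IsPGroup.of_card (n := 8) (by rw [Nat.card_congr equivProd]; simp)

end IwahoriGroup

/-- Two elementary matrices show that the group with `α₁⁵ = β₁⁻¹` and `α₂⁵ = β₂` is capable. -/
theorem isCapable_phi6Group_four_one : IsCapable 5 (Phi6Group 4 0 0 1) := by
  let x : IwahoriGroup := ⟨0, 2, 0, 0⟩
  let y : IwahoriGroup := ⟨0, 0, 1, 0⟩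
  have h : ∀ g : IwahoriGroup, rightComm 1 g = 1 := fun g ↦
    rightComm_eq_one_iff.mpr (Commute.one_left g)
  have hxx : rightComm (rightComm (rightComm x y) x) x = 1 := by decide
  have hyy : rightComm (rightComm (rightComm x y) y) y = 1 := by decide
  have hxyx : rightComm (rightComm (rightComm (rightComm x y) x) y) x = 1 := by decide
  have hxyy : rightComm (rightComm (rightComm (rightComm x y) x) y) y = 1 := by decide
  have hyx : rightComm (rightComm (rightComm x y) y) x =
    rightComm (rightComm (rightComm x y) x) y := by decide
  refine isCapable_of_model IwahoriGroup.isPGroup (x := x) (y := y) (e := 3) (f := 2)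
    (by decide) (by decide) ?_ ⟨x, by simp, y, by simp, by decide⟩
  rintro s (rfl | rfl) t (rfl | rfl) u (rfl | rfl) <;> simp only [h, hxx, hyy, hyx, hxyx, hxyy]

end Capability

/-! ### Automorphisms of degree four -/

section Eigenvectors

/-- Lagrange interpolation at the roots `2, 3, 4` of `1 + X + X² + X³` modulo `5`, for the orbit
`p, q, r, t` of a vector under an operator of trace zero: the three projections of `p` are
eigenvectors, and `p` is a combination of them. -/
theorem eigen_projections {B : Type*} [AddCommGroup B] {p q r t : B} (hp : 5 • p = 0)
    (hq : 5 • q = 0) (hr : 5 • r = 0) (h : p + q + r + t = 0) :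
    t + 3 • r + 2 • q = 2 • (r + 3 • q + 2 • p) ∧
    t + 4 • r + 3 • q = 3 • (r + 4 • q + 3 • p) ∧
    t + q = 4 • (r + p) ∧
    p = 3 • (r + 3 • q + 2 • p) + 4 • (r + 4 • q + 3 • p) + 3 • (r + p) := by
  obtain rfl : t = -(p + q + r) := (neg_eq_of_add_eq_zero_right h).symm
  refine ⟨?_, ?_, ?_, ?_⟩
  · rw [← sub_eq_zero]
    calc _ = -(5 • p) - 5 • q := by abel
      _ = 0 := by rw [hp, hq]; simp
  · rw [← sub_eq_zero]
    calc _ = -(2 • (5 • p)) - 2 • (5 • q) := by abel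
      _ = 0 := by rw [hp, hq]; simp
  · rw [← sub_eq_zero]
    calc _ = -(5 • p) - 5 • r := by abel
      _ = 0 := by rw [hp, hr]; simp
  · rw [← sub_eq_zero]
    calc _ = -(4 • (5 • p)) - 5 • (5 • q) - 2 • (5 • r) := by abel
      _ = 0 := by rw [hp, hq, hr]; simp

/-- An endomorphism of trace zero of a group of type `(5, 5)` has a basis of eigenvectors, with
eigenvalues among `2, 3, 4`. -/
theorem exists_eigen_generators {A : Type*} [CommGroup A] (hA : Nat.card A = 25)
    (h5 : ∀ a : A, a ^ 5 = 1) (s : A →* A) (hs : ∀ a, a * s a * s (s a) * s (s (s a)) = 1) :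
    ∃ u v : A, ∃ l ∈ ({2, 3, 4} : Set ℕ), ∃ m ∈ ({2, 3, 4} : Set ℕ),
      s u = u ^ l ∧ s v = v ^ m ∧ Subgroup.closure {u, v} = ⊤ := by
  let E : Set A := {u | ∃ l ∈ ({2, 3, 4} : Set ℕ), s u = u ^ l}
  have hE : Subgroup.closure E = ⊤ := by
    rw [← top_le_iff]
    intro a _
    obtain ⟨e2, e3, e4, e⟩ := eigen_projections (B := Additive A) (p := .ofMul a)
      (q := .ofMul (s a)) (r := .ofMul (s (s a))) (t := .ofMul (s (s (s a))))
      (h5 a) (h5 _) (h5 _) (hs a)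
    have m2 : s (s a) * s a ^ 3 * a ^ 2 ∈ E :=
      ⟨2, by simp, by simp only [map_mul, map_pow]; exact e2⟩
    have m3 : s (s a) * s a ^ 4 * a ^ 3 ∈ E :=
      ⟨3, by simp, by simp only [map_mul, map_pow]; exact e3⟩
    have m4 : s (s a) * a ∈ E := ⟨4, by simp, by simp only [map_mul]; exact e4⟩
    have e' : a = (s (s a) * s a ^ 3 * a ^ 2) ^ 3 * (s (s a) * s a ^ 4 * a ^ 3) ^ 4 *
      (s (s a) * a) ^ 3 := e
    rw [e']
    exact mul_mem (mul_mem (pow_mem (Subgroup.subset_closure m2) 3)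
      (pow_mem (Subgroup.subset_closure m3) 4)) (pow_mem (Subgroup.subset_closure m4) 3)
  have hfin : Finite A := Nat.finite_of_card_ne_zero (by rw [hA]; norm_num)
  have hcard : ∀ u : A, Nat.card (Subgroup.zpowers u) ∣ 5 := fun u ↦ by
    rw [Nat.card_zpowers]; exact orderOf_dvd_of_pow_eq_one (h5 u)
  have hlt : ∀ u : A, ∃ v ∈ E, v ∉ Subgroup.zpowers u := fun u ↦ by
    by_contra! h
    have : Subgroup.zpowers u = ⊤ := top_le_iff.mp (hE ▸ (Subgroup.closure_le _).mpr h)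
    have h1 := hcard u
    rw [this, Subgroup.card_top, hA] at h1
    norm_num at h1
  obtain ⟨u, ⟨l, hl, hu⟩, hu1⟩ := hlt 1
  obtain ⟨v, ⟨m, hm, hv⟩, hvu⟩ := hlt u
  refine ⟨u, v, l, hl, m, hm, hu, hv, ?_⟩
  have hu5 : orderOf u = 5 := by
    have : Fact (Nat.Prime 5) := ⟨by norm_num⟩
    refine orderOf_eq_prime (h5 u) fun h ↦ hu1 ?_
    rw [h]; exact one_mem _
  have hle : Subgroup.zpowers u ≤ Subgroup.closure {u, v} :=
    (Subgroup.zpowers_le).mpr (Subgroup.subset_closure (by simp))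
  have hdvd : Nat.card (Subgroup.closure {u, v}) ∣ 5 ^ 2 := by
    have := Subgroup.card_subgroup_dvd_card (Subgroup.closure {u, v})
    rwa [hA] at this
  obtain ⟨k, hk, hk'⟩ := (Nat.dvd_prime_pow (by norm_num)).mp hdvd
  refine Subgroup.eq_top_of_card_eq _ ?_
  have hne : k = 2 := by
    by_contra hk2
    have h1 : Nat.card (Subgroup.closure {u, v}) ≤ Nat.card (Subgroup.zpowers u) := by
      rw [hk', Nat.card_zpowers, hu5]
      calc 5 ^ k ≤ 5 ^ 1 := Nat.pow_le_pow_right (by norm_num) (by lia)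
        _ = 5 := pow_one 5
    have h2 := Subgroup.eq_of_le_of_card_ge hle h1
    exact hvu (h2 ▸ Subgroup.subset_closure (by simp))
  rw [hk', hne, hA]
  norm_num

/-- An automorphism of a finite nilpotent group of odd order whose square is trivial and which acts
trivially on the abelianization is trivial: each coset of the commutator subgroup has odd size, so
it contains a fixed point. -/
theorem eq_one_of_sq_eq_one {G : Type*} [Group G] [Finite G] [Group.IsNilpotent G]
    (hodd : ¬ 2 ∣ Nat.card (commutator G)) {τ : MulAut G} (h2 : τ ^ 2 = 1)
    (h : ∀ g, g⁻¹ * τ g ∈ commutator G) : τ = 1 := by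
  have hτ : ∀ g, τ (τ g) = g := fun g ↦ by
    have := DFunLike.congr_fun h2 g
    rwa [sq, MulAut.mul_apply] at this
  have hmem : ∀ g (c : commutator G), g⁻¹ * τ (g * c) ∈ commutator G := fun g c ↦ by
    rw [map_mul, ← mul_assoc]
    exact mul_mem (h g) (by simpa using mul_mem c.2 (h c))
  have htop : MonoidHom.eqLocus (τ : G →* G) (MonoidHom.id G) = ⊤ := by
    refine eq_top_of_sup_commutator (top_le_iff.mp fun g _ ↦ ?_)
    let f : commutator G → commutator G := fun c ↦ ⟨g⁻¹ * τ (g * c), hmem g c⟩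
    have hf : Function.Involutive f := fun c ↦ Subtype.ext (by simp [f, hτ])
    have := Fintype.ofFinite (commutator G)
    have : Fact (Nat.Prime 2) := ⟨Nat.prime_two⟩
    obtain ⟨c, hc⟩ := Equiv.Perm.exists_fixed_point_of_prime (p := 2) (n := 1)
      (by rwa [← Nat.card_eq_fintype_card]) (σ := hf.toPerm)
      (by ext c; simp [sq, hf c])
    have hc' : g⁻¹ * τ (g * c) = c := congrArg Subtype.val hc
    have h1 : g * c ∈ MonoidHom.eqLocus (τ : G →* G) (MonoidHom.id G) :=
      inv_mul_eq_iff_eq_mul.mp hc'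
    have h3 := Subgroup.mul_mem_sup h1 (inv_mem c.2)
    rwa [mul_inv_cancel_right] at h3
  ext g
  exact (htop ▸ Subgroup.mem_top g : g ∈ MonoidHom.eqLocus (τ : G →* G) (MonoidHom.id G))

/-- A lift of generators of the abelianization generates a finite nilpotent group. -/
theorem closure_pair_eq_top {G : Type*} [Group G] [Finite G] [Group.IsNilpotent G] {x y : G}
    {H : Type*} [Group H] (π : G →* H) (hker : π.ker ≤ commutator G)
    (h : Subgroup.closure {π x, π y} = ⊤) : Subgroup.closure {x, y} = ⊤ := by
  refine eq_top_of_sup_commutator (top_le_iff.mp ?_)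
  refine le_trans ?_ (sup_le_sup_left hker _)
  rw [← Subgroup.comap_map_eq, MonoidHom.map_closure, Set.image_pair, h, Subgroup.comap_top]

/-- The action of an automorphism making `G` a `σ`-group of degree four, on suitable generators of
`G`: they are eigenvectors modulo `G'`, and the eigenvalues are not both `-1`. -/
theorem exists_generators_of_isSigmaGroup {G : Type*} [Group G] [Finite G] (hG : IsPGroup 5 G)
    (hA : Nonempty (Abelianization G ≃* Multiplicative (ZMod 5 × ZMod 5)))
    (hσ : IsSigmaGroup 4 G) :
    ∃ (σ : G →* G) (x y : G), ∃ l ∈ ({2, 3, 4} : Set ℕ), ∃ m ∈ ({2, 3, 4} : Set ℕ),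
      ¬ (l = 4 ∧ m = 4) ∧ Subgroup.closure {x, y} = ⊤ ∧
      (∃ c ∈ lcs G 1, σ x = x ^ l * c) ∧ ∃ c ∈ lcs G 1, σ y = y ^ m * c := by
  have h5' : ∀ b : Multiplicative (ZMod 5 × ZMod 5), b ^ 5 = 1 := by decide
  have hp : Fact (Nat.Prime 5) := ⟨by norm_num⟩
  have hnil : Group.IsNilpotent G := hG.isNilpotent
  obtain ⟨e⟩ := hA
  obtain ⟨σ, hord, htr⟩ := hσ
  let s : Abelianization G →* Abelianization G := Abelianization.map σ.toMonoidHom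
  have hsof : ∀ g, s (Abelianization.of g) = Abelianization.of (σ g) := fun g ↦ rfl
  have hsurj : Function.Surjective (Abelianization.of (G := G)) := QuotientGroup.mk'_surjective _
  have h5 : ∀ a : Abelianization G, a ^ 5 = 1 := fun a ↦ e.injective (by
    rw [map_pow, map_one, h5'])
  have hcard : Nat.card (Abelianization G) = 25 := by
    rw [Nat.card_congr e.toEquiv]; simp
  have hmem : ∀ g, g ∈ lcs G 1 ↔ Abelianization.of g = 1 := fun g ↦ by
    rw [lcs_one_eq_commutator, ← Abelianization.ker_of, MonoidHom.mem_ker]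
  have hs : ∀ a, a * s a * s (s a) * s (s (s a)) = 1 := fun a ↦ by
    obtain ⟨g, rfl⟩ := hsurj a
    have h1 := htr g
    rw [← lcs_one_eq_commutator, hmem] at h1
    simpa [List.range_succ, pow_succ, mul_assoc, hsof] using h1
  obtain ⟨u, v, l, hl, m, hm, hu, hv, huv⟩ := exists_eigen_generators hcard h5 s hs
  obtain ⟨x, rfl⟩ := hsurj u
  obtain ⟨y, rfl⟩ := hsurj v
  have hS : Subgroup.closure {x, y} = ⊤ :=
    closure_pair_eq_top (Abelianization.of (G := G)) (Abelianization.ker_of G).le huv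
  have hlift : ∀ (z : G) (n : ℕ), s (Abelianization.of z) = Abelianization.of z ^ n →
      ∃ c ∈ lcs G 1, σ z = z ^ n * c := fun z n hz ↦ by
    refine ⟨(z ^ n)⁻¹ * σ z, (hmem _).mpr ?_, by simp⟩
    rw [map_mul, map_inv, map_pow, ← hsof, hz, inv_mul_cancel]
  refine ⟨σ.toMonoidHom, x, y, l, hl, m, hm, ?_, hS, hlift x l hu, hlift y m hv⟩
  rintro ⟨rfl, rfl⟩
  -- If `σ` inverts `G / G'`, then `σ²` is trivial.
  have hinv : s.comp s = MonoidHom.id _ := by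
    refine MonoidHom.eq_of_eqOn_dense huv ?_
    have h4 : ∀ a : Abelianization G, (a ^ 4) ^ 4 = a := fun a ↦ by
      rw [← pow_mul, show 4 * 4 = 5 * 3 + 1 from rfl, pow_succ, pow_mul, h5, one_pow, one_mul]
    rintro _ (rfl | rfl)
    · rw [MonoidHom.comp_apply, hu, map_pow, hu, h4]; rfl
    · rw [MonoidHom.comp_apply, hv, map_pow, hv, h4]; rfl
  have hodd : ¬ 2 ∣ Nat.card (commutator G) := by
    obtain ⟨k, hk⟩ := IsPGroup.iff_card.mp (hG.to_subgroup (commutator G))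
    rw [hk]
    exact fun h ↦ absurd (Nat.prime_two.dvd_of_dvd_pow h) (by norm_num)
  have h1 : σ ^ 2 = 1 := by
    refine eq_one_of_sq_eq_one hodd ?_ fun g ↦ ?_
    · have h4 := pow_orderOf_eq_one σ
      rw [hord] at h4
      rwa [← pow_mul]
    · rw [← lcs_one_eq_commutator, hmem, map_mul, map_inv, inv_mul_eq_one]
      exact (DFunLike.congr_fun hinv (Abelianization.of g)).symm
  have := orderOf_dvd_of_pow_eq_one h1
  rw [hord] at this
  norm_num at this

end Eigenvectors

/-! ### Fifth powers in class three -/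

section ClassThree

variable {G : Type*} [Group G] {x y : G}

/-- The triple commutators `[x, y, x]` and `[x, y, y]` are independent modulo fifth powers. -/
def IndependentTripleComm (x y : G) : Prop :=
  ∀ i j : ℤ, rightComm (rightComm x y) x ^ i * rightComm (rightComm x y) y ^ j = 1 → 5 ∣ i ∧ 5 ∣ j

theorem zpow_eq_zpow_of_dvd {g : G} (hg : g ^ 5 = 1) {i j : ℤ} (h : (5 : ℤ) ∣ i - j) :
    g ^ i = g ^ j := by
  obtain ⟨k, hk⟩ := h
  have h5 : g ^ (5 : ℤ) = 1 := by exact_mod_cast hg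
  rw [show i = j + 5 * k by lia, zpow_add, zpow_mul, h5, one_zpow, mul_one]

theorem exists_eq_of_mem_lcs_two (h : lcs G 3 = ⊥) (hS : Subgroup.closure {x, y} = ⊤) {g : G}
    (hg : g ∈ lcs G 2) : ∃ i j : ℤ,
      g = rightComm (rightComm x y) x ^ i * rightComm (rightComm x y) y ^ j := by
  have hle := lcs_two_le hS hg
  have hn : (lcs G 3 ⊔ Subgroup.zpowers (rightComm (rightComm x y) x)).Normal :=
    normal_of_lcs_le (n := 2) le_sup_left (sup_le (lcs_le (by norm_num))
      ((Subgroup.zpowers_le).mpr (rightComm_mem_lcs_left (rightComm_mem_lcs_one x y) x)))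
  obtain ⟨u, hu, v, hv, rfl⟩ := Subgroup.mem_sup_of_normal_left.mp hle
  rw [h, bot_sup_eq] at hu
  obtain ⟨i, rfl⟩ := Subgroup.mem_zpowers_iff.mp hu
  obtain ⟨j, rfl⟩ := Subgroup.mem_zpowers_iff.mp hv
  exact ⟨i, j, rfl⟩

/-- If `w⁵ ∈ G'` and `[x, y, w]` has order divisible by five, then `w⁵ ∈ γ₃`, because a power of
`[x, y]` modulo `γ₃` commutes with `w` only if it is a power of `[x, y]⁵`. -/
theorem pow_five_mem_lcs_two (h : lcs G 3 = ⊥) (hS : Subgroup.closure {x, y} = ⊤)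
    (hb : rightComm x y ^ 5 ∈ lcs G 2) {w : G} (hw : w ^ 5 ∈ lcs G 1)
    (hind : ∀ i : ℤ, rightComm (rightComm x y) w ^ i = 1 → 5 ∣ i) : w ^ 5 ∈ lcs G 2 := by
  obtain ⟨u, hu, v, hv, huv⟩ := Subgroup.mem_sup_of_normal_left.mp (lcs_one_le hS hw)
  obtain ⟨i, rfl⟩ := Subgroup.mem_zpowers_iff.mp hv
  have hz := fun {a : G} (ha : a ∈ lcs G 2) ↦ commute_of_lcs_succ h ha
  have h1 : rightComm (w ^ 5) w = 1 := rightComm_eq_one_iff.mpr ((Commute.refl w).pow_left 5)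
  rw [← huv, (hz hu _).eq, rightComm_mul_central_left (hz hu), rightComm_zpow_left
    (hz (rightComm_mem_lcs_left (rightComm_mem_lcs_one x y) w) _).symm] at h1
  obtain ⟨k, rfl⟩ := hind i h1
  rw [← huv, zpow_mul]
  exact mul_mem hu (zpow_mem (by exact_mod_cast hb) k)

theorem pow_five_eq_one_of_mem (h : lcs G 3 = ⊥) (hS : Subgroup.closure {x, y} = ⊤)
    (hx : x ^ 5 ∈ lcs G 2) {a : G} (ha : a ∈ lcs G 1) : a ^ 5 = 1 := by
  obtain ⟨p, p1, p2⟩ := pow_five_eq_one_of_class_three h y hx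
  have hz := fun {a : G} (ha : a ∈ lcs G 2) ↦ commute_of_lcs_succ h ha
  have hz' : ∀ (g : G) (i : ℤ), g ^ 5 = 1 → (g ^ i) ^ 5 = 1 := fun g i hg ↦ by
    rw [← zpow_natCast, zpow_comm, zpow_natCast, hg, one_zpow]
  obtain ⟨u, hu, v, hv, rfl⟩ := Subgroup.mem_sup_of_normal_left.mp (lcs_one_le hS ha)
  obtain ⟨i, rfl⟩ := Subgroup.mem_zpowers_iff.mp hv
  obtain ⟨j, k, e⟩ := exists_eq_of_mem_lcs_two h hS hu
  rw [(hz hu _).mul_pow, hz' _ _ p, e, Commute.mul_pow, hz' _ _ p1, hz' _ _ p2, mul_one, mul_one]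
  exact (hz (zpow_mem (rightComm_mem_lcs_left (rightComm_mem_lcs_one x y) x) j) _)

/-- Equivariance of the fifth power map `G / G' → γ₃`: if an endomorphism acts on `x`, `y`, `w`
modulo `G'` with eigenvalues `l`, `m`, `n`, then it acts on `[x, y, x]` and `[x, y, y]` with
eigenvalues `l² m` and `l m²`, and a component of `w⁵` can be non-trivial only where the eigenvalue
is `n`. -/
theorem exists_pow_five_eq (h : lcs G 3 = ⊥) (hS : Subgroup.closure {x, y} = ⊤)
    (hind : IndependentTripleComm x y) (hx5 : x ^ 5 ∈ lcs G 2) (σ : G →* G) {l m n : ℕ}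
    (hx : ∃ c ∈ lcs G 1, σ x = x ^ l * c) (hy : ∃ c ∈ lcs G 1, σ y = y ^ m * c) {w : G}
    (hw : ∃ c ∈ lcs G 1, σ w = w ^ n * c) (hw5 : w ^ 5 ∈ lcs G 2) : ∃ a b : ℤ,
      w ^ 5 = rightComm (rightComm x y) x ^ a * rightComm (rightComm x y) y ^ b ∧
        (5 : ℤ) ∣ a * (l * m * l - n) ∧ (5 : ℤ) ∣ b * (l * m * m - n) := by
  obtain ⟨c, hc, hx⟩ := hx
  obtain ⟨d, hd, hy⟩ := hy
  obtain ⟨f, hf, hw⟩ := hw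
  obtain ⟨a, b, e⟩ := exists_eq_of_mem_lcs_two h hS hw5
  have hz := fun {a : G} (ha : a ∈ lcs G 2) ↦ commute_of_lcs_succ h ha
  have hmem := fun g ↦ rightComm_mem_lcs_left (rightComm_mem_lcs_one x y) g
  have h1 : σ (w ^ 5) = (w ^ 5) ^ n := by
    rw [map_pow, hw, mul_pow_five_of_class_three h _
      (fun a ha ↦ pow_five_eq_one_of_mem h hS hx5 ha) hf, ← pow_mul, ← pow_mul, mul_comm]
  have tri := fun z (k : ℕ) {u} (hu : u ∈ lcs G 1) ↦
    rightComm_rightComm_of_class_three h x y z l m k hc hd hu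
  simp only [zpow_natCast] at tri
  rw [e, map_mul, map_zpow, map_zpow, map_rightComm, map_rightComm, map_rightComm,
    map_rightComm, hx, hy, tri x l hc, tri y m hd, ← zpow_mul, ← zpow_mul,
    Commute.mul_pow (hz (zpow_mem (hmem x) a) _),
    ← zpow_natCast, ← zpow_natCast, ← zpow_mul, ← zpow_mul, ← div_eq_one, div_eq_mul_inv,
    mul_inv_rev, ← zpow_neg, ← zpow_neg] at h1
  have h2 := hind (l * m * l * a - a * n) (l * m * m * b - b * n) (by
    rw [sub_eq_add_neg, sub_eq_add_neg, zpow_add, zpow_add, ← h1, mul_assoc,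
      (hz (zpow_mem (hmem x) (-(a * n))) _).eq]
    simp only [mul_assoc])
  refine ⟨a, b, e, ?_, ?_⟩
  · rw [mul_sub, mul_comm a]; exact h2.1
  · rw [mul_sub, mul_comm b]; exact h2.2

/-- The elements `x`, `y` generate the group and satisfy `x⁵ = [x, y, x]ᵃ [x, y, y]ᵇ` and
`y⁵ = [x, y, x]ᶜ [x, y, y]ᵈ`. -/
structure PowerRelations (x y : G) (a b c d : ℤ) : Prop where
  closure_eq_top : Subgroup.closure {x, y} = ⊤
  pow_left : x ^ 5 = rightComm (rightComm x y) x ^ a * rightComm (rightComm x y) y ^ b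
  pow_right : y ^ 5 = rightComm (rightComm x y) x ^ c * rightComm (rightComm x y) y ^ d

theorem PowerRelations.swap (h : lcs G 3 = ⊥) {a b c d : ℤ} (H : PowerRelations x y a b c d) :
    PowerRelations y x (-d) (-c) (-b) (-a) := by
  have hz := fun {a : G} (ha : a ∈ lcs G 2) ↦ commute_of_lcs_succ h ha
  have hmem := fun g ↦ rightComm_mem_lcs_left (rightComm_mem_lcs_one x y) g
  have e : ∀ g, rightComm (rightComm y x) g = (rightComm (rightComm x y) g)⁻¹ := fun g ↦ by
    have := rightComm_zpow_left (hz (hmem g) (rightComm x y)).symm (-1)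
    rwa [zpow_neg_one, zpow_neg_one, rightComm_inv] at this
  refine ⟨by rw [Set.pair_comm]; exact H.closure_eq_top, ?_, ?_⟩
  · rw [e, e, inv_zpow', inv_zpow', neg_neg, neg_neg, H.pow_right,
      (hz (zpow_mem (hmem x) c) _).eq]
  · rw [e, e, inv_zpow', inv_zpow', neg_neg, neg_neg, H.pow_left,
      (hz (zpow_mem (hmem x) a) _).eq]

/-- Replacing `x` by `xⁱ` brings the power relations to those of a group `Φ₆`; the resulting
epimorphism from `Φ₆` is an isomorphism because of the orders. -/
theorem PowerRelations.nonempty_mulEquiv (h : lcs G 3 = ⊥) (hcard : Nat.card G = 5 ^ 5)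
    {a b c d i : ℤ} (H : PowerRelations x y a b c d) (hi : ¬ (5 : ℤ) ∣ i)
    {k₁₁ k₁₂ k₂₁ k₂₂ : ℕ} (h₁₁ : (5 : ℤ) ∣ a - i * k₁₁) (h₁₂ : (5 : ℤ) ∣ b - k₁₂)
    (h₂₁ : (5 : ℤ) ∣ c - i * i * k₂₁) (h₂₂ : (5 : ℤ) ∣ d - i * k₂₂) :
    Nonempty (G ≃* Phi6Group k₁₁ k₁₂ k₂₁ k₂₂) := by
  have hmem := fun g ↦ rightComm_mem_lcs_left (rightComm_mem_lcs_one x y) g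
  have hz := fun {a : G} (ha : a ∈ lcs G 2) ↦ commute_of_lcs_succ h ha
  have hx5 : x ^ 5 ∈ lcs G 2 :=
    H.pow_left ▸ mul_mem (zpow_mem (hmem x) a) (zpow_mem (hmem y) b)
  obtain ⟨-, p1, p2⟩ := pow_five_eq_one_of_class_three h y hx5
  have tri : ∀ z (k : ℤ), rightComm (rightComm (x ^ i) y) (z ^ k) =
      rightComm (rightComm x y) z ^ (i * k) := fun z k ↦ by
    simpa using rightComm_rightComm_of_class_three h x y z i 1 k (one_mem _) (one_mem _)
      (one_mem _)
  have tx := tri x i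
  have ty : rightComm (rightComm (x ^ i) y) y = rightComm (rightComm x y) y ^ i := by
    simpa using tri y 1
  have hX : (x ^ i) ^ 5 = rightComm (rightComm (x ^ i) y) (x ^ i) ^ k₁₁ *
      rightComm (rightComm (x ^ i) y) y ^ k₁₂ := by
    have e1 : (x ^ i) ^ 5 = (x ^ 5) ^ i := by
      rw [← zpow_natCast, zpow_comm, zpow_natCast]
    rw [e1, H.pow_left, Commute.mul_zpow (hz (zpow_mem (hmem x) a) _), tx, ty, ← zpow_natCast,
      ← zpow_natCast, ← zpow_mul, ← zpow_mul, ← zpow_mul, ← zpow_mul]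
    rw [zpow_eq_zpow_of_dvd p1 (i := a * i) (j := i * i * k₁₁),
      zpow_eq_zpow_of_dvd p2 (i := b * i) (j := i * k₁₂)]
    · rw [mul_comm b, ← mul_sub]
      exact Dvd.dvd.mul_left h₁₂ i
    · rw [show a * i - i * i * k₁₁ = i * (a - i * k₁₁) by ring]
      exact Dvd.dvd.mul_left h₁₁ i
  have hY : y ^ 5 = rightComm (rightComm (x ^ i) y) (x ^ i) ^ k₂₁ *
      rightComm (rightComm (x ^ i) y) y ^ k₂₂ := by
    rw [H.pow_right, tx, ty, ← zpow_natCast, ← zpow_natCast, ← zpow_mul, ← zpow_mul,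
      zpow_eq_zpow_of_dvd p1 h₂₁, zpow_eq_zpow_of_dvd p2 h₂₂]
  let F : Phi6Group k₁₁ k₁₂ k₂₁ k₂₂ →* G := phi6Lift h hX hY
  have hfin : Finite G := Nat.finite_of_card_ne_zero (by rw [hcard]; norm_num)
  have hsurj : Function.Surjective F := by
    rw [← MonoidHom.range_eq_top, ← top_le_iff, ← H.closure_eq_top, Subgroup.closure_le]
    have hx25 : x ^ 25 = 1 := by
      rw [show 25 = 5 * 5 from rfl, pow_mul]
      exact pow_five_eq_one_of_mem h H.closure_eq_top hx5 (lcs_le one_le_two hx5)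
    have hxi : x ^ i ∈ F.range := ⟨Phi6Group.a1, Phi6Group.phi6Lift_a1 h hX hY⟩
    refine Set.insert_subset_iff.mpr ⟨?_, Set.singleton_subset_iff.mpr ?_⟩
    · obtain ⟨u, v, huv⟩ : IsCoprime i 25 := by
        have := ((Prime.coprime_iff_not_dvd (by norm_num)).mpr hi).symm
        simpa using IsCoprime.pow_right (n := 2) this
      have : x = (x ^ i) ^ u := by
        have h25 : x ^ (25 : ℤ) = 1 := by exact_mod_cast hx25
        conv_lhs => rw [← zpow_one x, ← huv, zpow_add, mul_comm v, zpow_mul _ 25, h25, one_zpow,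
          mul_one, mul_comm, zpow_mul]
      exact this ▸ zpow_mem hxi u
    · exact ⟨Phi6Group.a2, Phi6Group.phi6Lift_a2 h hX hY⟩
  have hbij : Function.Bijective F := by
    rw [Nat.bijective_iff_surjective_and_card]
    refine ⟨hsurj, le_antisymm ?_ (Nat.card_le_card_of_surjective F hsurj)⟩
    rw [hcard]
    exact Nat.le_of_dvd (by norm_num) Phi6Group.card_dvd
  exact ⟨(MulEquiv.ofBijective F hbij).symm⟩

end ClassThree

/-! ### The classification -/

section Classification

/-- `⟨3125, 11⟩` and `⟨3125, 14⟩` have no proper descendants: generators lifting `α₁` and `α₂`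
satisfy the relations that force class three. -/
theorem nonempty_mulEquiv_of_quotient {G : Type*} [Group G] [Finite G] (hG : IsPGroup 5 G) {k : ℕ}
    (hk : ¬ 5 ∣ k) (hk' : ¬ 5 ∣ k + 1) (h : Nonempty (G ⧸ lcs G 3 ≃* Phi6Group k 0 0 1)) :
    Nonempty (G ≃* Phi6Group k 0 0 1) := by
  have hp : Fact (Nat.Prime 5) := ⟨by norm_num⟩
  have hnil : Group.IsNilpotent G := hG.isNilpotent
  obtain ⟨e⟩ := h
  let π : G →* Phi6Group k 0 0 1 := (e : G ⧸ lcs G 3 →* _).comp (QuotientGroup.mk' (lcs G 3))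
  have hker : π.ker = lcs G 3 := by
    rw [MonoidHom.ker_mulEquiv_comp, QuotientGroup.ker_mk']
  have hsurj : Function.Surjective π := e.surjective.comp (QuotientGroup.mk'_surjective _)
  obtain ⟨x, hx⟩ := hsurj Phi6Group.a1
  obtain ⟨y, hy⟩ := hsurj Phi6Group.a2
  have hS : Subgroup.closure {x, y} = ⊤ := by
    refine closure_pair_eq_top π ?_ (by rw [hx, hy, Phi6Group.closure_eq_top])
    rw [hker, ← lcs_one_eq_commutator]
    exact lcs_le (by norm_num)
  have hmem : ∀ {u v : G}, π u = π v → v⁻¹ * u ∈ lcs G 3 := fun huv ↦ by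
    rw [← hker, MonoidHom.mem_ker, map_mul, map_inv, huv, inv_mul_cancel]
  have h1 : π (x ^ 5) = π (rightComm (rightComm x y) x ^ (k : ℤ)) := by
    simp only [map_pow, map_rightComm, hx, hy, Phi6Group.a1_pow_five, zpow_natCast,
      pow_zero, mul_one]
  have h2 : π (y ^ 5) = π (rightComm (rightComm x y) y ^ (1 : ℤ)) := by
    simp only [map_pow, map_rightComm, hx, hy, Phi6Group.a2_pow_five, zpow_one,
      pow_zero, pow_one, one_mul]
  have hbot : lcs G 3 = ⊥ := lcs_three_eq_bot hS (a := k) (b := 1) (by exact_mod_cast hk)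
    (by norm_num) (by exact_mod_cast hk') (hmem h1) (hmem h2) (by simp) (by simp)
  refine ⟨MulEquiv.ofBijective π ⟨?_, hsurj⟩⟩
  rw [← MonoidHom.ker_eq_bot_iff, hker, hbot]

variable {G : Type*} [Group G] {x y : G}

/-- The classification when `x⁵` is a power of `[x, y, x]` and `y⁵` is a power of `[x, y, y]`. If
neither is trivial, the ratio `a / d` modulo five is the invariant, and exchanging the generators
inverts it. -/
theorem PowerRelations.cases_diagonal (h : lcs G 3 = ⊥) (hcard : Nat.card G = 5 ^ 5)
    {a b c d : ℤ} (H : PowerRelations x y a b c d) (hb : (5 : ℤ) ∣ b) (hc : (5 : ℤ) ∣ c) :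
    (Nonempty (G ≃* G3125_11) ∨ Nonempty (G ≃* G3125_14)) ∨
      Nonempty (G ≃* G3125_3) ∨ Nonempty (G ≃* G3125_4) ∨ Nonempty (G ≃* G3125_7) := by
  have H' := H.swap h
  have hb' : (5 : ℤ) ∣ -b := (dvd_neg).mpr hb
  have hc' : (5 : ℤ) ∣ -c := (dvd_neg).mpr hc
  have hcases : ((5 : ℤ) ∣ a ∧ (5 : ℤ) ∣ d) ∨ (¬ (5 : ℤ) ∣ a ∧ (5 : ℤ) ∣ d) ∨
      ((5 : ℤ) ∣ a ∧ ¬ (5 : ℤ) ∣ d) ∨ (¬ (5 : ℤ) ∣ d ∧ (5 : ℤ) ∣ a - d) ∨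
      (¬ (5 : ℤ) ∣ d ∧ (5 : ℤ) ∣ a - d * 2) ∨ (¬ (5 : ℤ) ∣ d ∧ (5 : ℤ) ∣ a - d * 4) ∨
      (¬ (5 : ℤ) ∣ a ∧ (5 : ℤ) ∣ d - a * 2) := by lia
  rcases hcases with ⟨ha, hd⟩ | ⟨ha, hd⟩ | ⟨ha, hd⟩ | ⟨hd, had⟩ | ⟨hd, had⟩ | ⟨hd, had⟩ | ⟨ha, had⟩
  · exact Or.inr (Or.inl (H.nonempty_mulEquiv h hcard (i := 1) (by norm_num) (by simpa using ha)
      (by simpa using hb) (by simpa using hc) (by simpa using hd)))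
  · exact Or.inr (Or.inr (Or.inl (H.nonempty_mulEquiv h hcard ha (by simp)
      (by simpa using hb) (by simpa using hc) (by simpa using hd))))
  · exact Or.inr (Or.inr (Or.inl (H'.nonempty_mulEquiv h hcard (i := -d) (by rwa [dvd_neg])
      (by simp) (by simpa using hc) (by simpa using hb) (by simpa using ha))))
  · exact Or.inl (Or.inr (H.nonempty_mulEquiv h hcard hd (by simpa using had)
      (by simpa using hb) (by simpa using hc) (by simp)))
  · exact Or.inl (Or.inl (H.nonempty_mulEquiv h hcard hd (by simpa using had)
      (by simpa using hb) (by simpa using hc) (by simp)))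
  · exact Or.inr (Or.inr (Or.inr (H.nonempty_mulEquiv h hcard hd (by simpa using had)
      (by simpa using hb) (by simpa using hc) (by simp))))
  · exact Or.inl (Or.inl (H'.nonempty_mulEquiv h hcard (i := -a) (by rwa [dvd_neg])
      (by push_cast; lia) (by simpa using hc) (by simpa using hb) (by simp)))

/-- The classification when `x⁵ = 1` and `y⁵` is a power of `[x, y, x]`; the exponent matters only
up to squares. -/
theorem PowerRelations.cases_nilpotent (h : lcs G 3 = ⊥) (hcard : Nat.card G = 5 ^ 5)
    {a b c d : ℤ} (H : PowerRelations x y a b c d) (ha : (5 : ℤ) ∣ a) (hb : (5 : ℤ) ∣ b)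
    (hd : (5 : ℤ) ∣ d) :
    Nonempty (G ≃* G3125_3) ∨ Nonempty (G ≃* G3125_5) ∨ Nonempty (G ≃* G3125_6) := by
  have hcases : (5 : ℤ) ∣ c ∨ (5 : ℤ) ∣ c - 1 ∨ (5 : ℤ) ∣ c - 4 ∨ (5 : ℤ) ∣ c - 2 ∨
    (5 : ℤ) ∣ c - 8 := by lia
  rcases hcases with hc | hc | hc | hc | hc
  · exact Or.inl (H.nonempty_mulEquiv h hcard (i := 1) (by norm_num) (by simpa using ha)
      (by simpa using hb) (by simpa using hc) (by simpa using hd))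
  · exact Or.inr (Or.inl (H.nonempty_mulEquiv h hcard (i := 1) (by norm_num) (by simpa using ha)
      (by simpa using hb) (by simpa using hc) (by simpa using hd)))
  · exact Or.inr (Or.inl (H.nonempty_mulEquiv h hcard (i := 2) (by norm_num) (by simpa using ha)
      (by simpa using hb) (by norm_num; exact hc) (by simpa using hd)))
  · exact Or.inr (Or.inr (H.nonempty_mulEquiv h hcard (i := 1) (by norm_num) (by simpa using ha)
      (by simpa using hb) (by simpa using hc) (by simpa using hd)))
  · exact Or.inr (Or.inr (H.nonempty_mulEquiv h hcard (i := 2) (by norm_num) (by simpa using ha)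
      (by simpa using hb) (by norm_num; exact hc) (by simpa using hd)))

/-- The eigenvalue conditions leave only the two shapes of power maps classified above, up to
exchanging the generators. -/
theorem cases_of_eigenvalues (h : lcs G 3 = ⊥) (hcard : Nat.card G = 5 ^ 5)
    (hS : Subgroup.closure {x, y} = ⊤) (hind : IndependentTripleComm x y)
    (hx5 : x ^ 5 ∈ lcs G 2) (hy5 : y ^ 5 ∈ lcs G 2) (σ : G →* G) {l m : ℕ}
    (hl : l ∈ ({2, 3, 4} : Set ℕ)) (hm : m ∈ ({2, 3, 4} : Set ℕ)) (hlm : ¬ (l = 4 ∧ m = 4))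
    (hx : ∃ c ∈ lcs G 1, σ x = x ^ l * c) (hy : ∃ c ∈ lcs G 1, σ y = y ^ m * c) :
    (Nonempty (G ≃* G3125_11) ∨ Nonempty (G ≃* G3125_14)) ∨
      Nonempty (G ≃* G3125_3) ∨ Nonempty (G ≃* G3125_4) ∨ Nonempty (G ≃* G3125_5) ∨
        Nonempty (G ≃* G3125_6) ∨ Nonempty (G ≃* G3125_7) := by
  obtain ⟨a, b, ex, ha, hb⟩ := exists_pow_five_eq h hS hind hx5 σ hx hy hx hx5
  obtain ⟨c, d, ey, hc, hd⟩ := exists_pow_five_eq h hS hind hx5 σ hx hy hy hy5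
  have H : PowerRelations x y a b c d := ⟨hS, ex, ey⟩
  have hcases : ((5 : ℤ) ∣ b ∧ (5 : ℤ) ∣ c) ∨ ((5 : ℤ) ∣ a ∧ (5 : ℤ) ∣ b ∧ (5 : ℤ) ∣ d) ∨
      ((5 : ℤ) ∣ a ∧ (5 : ℤ) ∣ c ∧ (5 : ℤ) ∣ d) := by
    clear ex ey H
    rcases hl with rfl | rfl | rfl <;> rcases hm with rfl | rfl | rfl <;> push_cast at * <;> lia
  rcases hcases with ⟨hb, hc⟩ | ⟨ha, hb, hd⟩ | ⟨ha, hc, hd⟩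
  · rcases H.cases_diagonal h hcard hb hc with h | h | h | h <;> simp only [h, true_or, or_true]
  · rcases H.cases_nilpotent h hcard ha hb hd with h | h | h <;> simp only [h, true_or, or_true]
  · rcases (H.swap h).cases_nilpotent h hcard ((dvd_neg).mpr hd) ((dvd_neg).mpr hc)
      ((dvd_neg).mpr ha) with h | h | h <;> simp only [h, true_or, or_true]

/-- The quotient `G / γ₄(G)` of a group that is not of coclass one. -/
theorem cases_quotient [Finite G] (hG : IsPGroup 5 G)
    (hA : Nonempty (Abelianization G ≃* Multiplicative (ZMod 5 × ZMod 5)))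
    (hm : IsMetabelian G) (hσ : IsSigmaGroup 4 G) (hco : ¬ HasCoclass 5 G 1) :
    (Nonempty (G ⧸ lcs G 3 ≃* G3125_11) ∨ Nonempty (G ⧸ lcs G 3 ≃* G3125_14)) ∨
      Nonempty (G ⧸ lcs G 3 ≃* G3125_3) ∨ Nonempty (G ⧸ lcs G 3 ≃* G3125_4) ∨
        Nonempty (G ⧸ lcs G 3 ≃* G3125_5) ∨ Nonempty (G ⧸ lcs G 3 ≃* G3125_6) ∨
          Nonempty (G ⧸ lcs G 3 ≃* G3125_7) := by
  obtain ⟨σ, x, y, l, hl, m, hm', hlm, hS, hx, hy⟩ := exists_generators_of_isSigmaGroup hG hA hσ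
  have h5' : ∀ b : Multiplicative (ZMod 5 × ZMod 5), b ^ 5 = 1 := by decide
  have hp : Fact (Nat.Prime 5) := ⟨by norm_num⟩
  have hnil : Group.IsNilpotent G := hG.isNilpotent
  obtain ⟨e⟩ := hA
  have h5 : ∀ g : G, g ^ 5 ∈ lcs G 1 := fun g ↦ by
    rw [lcs_one_eq_commutator, ← Abelianization.ker_of, MonoidHom.mem_ker]
    exact e.injective (by rw [map_pow, map_pow, map_one, h5'])
  have hindex : (lcs G 1).index = 5 ^ 2 := by
    rw [lcs_one_eq_commutator]
    exact (Nat.card_congr e.toEquiv).trans (by simp)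
  let π := QuotientGroup.mk' (lcs G 3)
  have hπ : ∀ g, π g = 1 ↔ g ∈ lcs G 3 := fun g ↦ QuotientGroup.eq_one_iff g
  have hbot : lcs (G ⧸ lcs G 3) 3 = ⊥ := lcs_quotient_self 3
  have hb := rightComm_mem_lcs_one x y
  have hb5 : rightComm x y ^ 5 ∈ lcs G 2 := rightComm_pow_five_mem (n := 0) trivial (h5 x) y
  have hc5 := fun g ↦ rightComm_pow_five_mem hb hb5 g
  -- If the two triple commutators are dependent modulo `γ₄`, a change of generators makes one
  -- of them vanish there.
  have h1 : rightComm (rightComm x y) x ∉ lcs G 3 := by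
    intro h
    refine hco (hasCoclass_one hnil (x := y) (y := x) (by rwa [Set.pair_comm]) hm (h5 y) hindex ?_)
    have : ∀ a g : G, rightComm a⁻¹ g = a * (rightComm a g)⁻¹ * a⁻¹ := fun a g ↦ by
      simp [rightComm, mul_assoc]
    rw [← rightComm_inv x y, this]
    exact (inferInstance : (lcs G 3).Normal).conj_mem _ (inv_mem h) _
  have h2 : ∀ i : ℤ, rightComm (rightComm x y) x ^ i * rightComm (rightComm x y) y ∉ lcs G 3 := by
    intro i h
    have e1 : rightComm x (x ^ i * y) = rightComm x y := by
      rw [rightComm_mul_right, rightComm_eq_one_iff.mpr (Commute.self_zpow x i)]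
      simp
    have hS' : Subgroup.closure {x, x ^ i * y} = ⊤ := by
      rw [← top_le_iff, ← hS, Subgroup.closure_le]
      have hx' : x ∈ Subgroup.closure {x, x ^ i * y} := Subgroup.subset_closure (by simp)
      refine Set.insert_subset_iff.mpr ⟨hx', Set.singleton_subset_iff.mpr ?_⟩
      have := mul_mem (inv_mem (zpow_mem hx' i))
        (Subgroup.subset_closure (by simp) : x ^ i * y ∈ Subgroup.closure {x, x ^ i * y})
      rwa [inv_mul_cancel_left] at this
    refine hco (hasCoclass_one hnil hS' hm (h5 x) hindex ?_)
    have hz := fun g ↦ commute_of_lcs_succ hbot (map_mem_lcs π (rightComm_mem_lcs_left hb g))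
    have hz' : ∀ u, Commute (rightComm (π (rightComm x y)) (π x) ^ i) u := fun u ↦ by
      rw [← map_rightComm]; exact (hz x u).zpow_left i
    rw [e1, ← hπ, map_rightComm, map_mul, map_zpow, rightComm_mul_right, rightComm_zpow_right,
      mul_assoc, (hz' _).eq, inv_mul_cancel_left, ← (hz' _).eq]
    · rw [← hπ, map_mul, map_zpow, map_rightComm π _ x, map_rightComm π _ y] at h
      exact h
    · rw [← map_rightComm]
      exact (hz x _).symm
  have hcard : Nat.card (G ⧸ lcs G 3) = 5 ^ 5 := by
    have := index_lcs_three_eq hS (h5 x) h1 h2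
    rw [hindex] at this
    rw [← Subgroup.index, this]
    norm_num
  have hSπ : Subgroup.closure {π x, π y} = ⊤ := by
    rw [← Set.image_pair, ← MonoidHom.map_closure, hS,
      Subgroup.map_top_of_surjective _ (QuotientGroup.mk'_surjective _)]
  have hind : IndependentTripleComm (π x) (π y) := by
    intro i j hij
    have hj : (5 : ℤ) ∣ j := by
      by_contra hj
      obtain ⟨u, v, huv⟩ := ((Prime.coprime_iff_not_dvd (by norm_num)).mpr hj).symm
      refine h2 (i * u) ((hπ _).mp ?_)
      have h3 : rightComm (rightComm (π x) (π y)) (π y) =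
          rightComm (rightComm (π x) (π y)) (π y) ^ (j * u) := by
        conv_lhs => rw [← zpow_one (rightComm _ _)]
        refine zpow_eq_zpow_of_dvd ?_ ⟨v, by linear_combination -huv⟩
        rw [← map_rightComm, ← map_rightComm, ← map_pow, hπ]
        exact hc5 y
      rw [map_mul, map_zpow, map_rightComm, map_rightComm, map_rightComm, map_rightComm, h3,
        zpow_mul, zpow_mul,
        ← Commute.mul_zpow, hij, one_zpow]
      rw [← map_rightComm, ← map_rightComm]
      exact (commute_of_lcs_succ hbot (map_mem_lcs π (rightComm_mem_lcs_left hb x)) _).zpow_left i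
    refine ⟨?_, hj⟩
    by_contra hi
    refine h1 ((hπ _).mp (eq_one_of_zpow_of_pow_five hi ?_ ?_))
    · have h3 : rightComm (rightComm (π x) (π y)) (π y) ^ j = 1 := by
        rw [zpow_eq_zpow_of_dvd (j := 0) ?_ (by simpa using hj), zpow_zero]
        rw [← map_rightComm, ← map_rightComm, ← map_pow, hπ]
        exact hc5 y
      rw [h3, mul_one] at hij
      rw [map_rightComm, map_rightComm, hij]
    · rw [← map_pow, hπ]
      exact hc5 x
  let σ' : G ⧸ lcs G 3 →* G ⧸ lcs G 3 :=
    QuotientGroup.map (lcs G 3) (lcs G 3) σ fun g hg ↦ map_mem_lcs σ hg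
  have hσ' : ∀ {z : G} {n : ℕ}, (∃ c ∈ lcs G 1, σ z = z ^ n * c) →
      ∃ c ∈ lcs (G ⧸ lcs G 3) 1, σ' (π z) = π z ^ n * c := by
    rintro z n ⟨c, hc, hz⟩
    refine ⟨π c, map_mem_lcs π hc, ?_⟩
    rw [← map_pow, ← map_mul, ← hz]
    rfl
  have hb5π : rightComm (π x) (π y) ^ 5 ∈ lcs (G ⧸ lcs G 3) 2 := by
    rw [← map_rightComm, ← map_pow]
    exact map_mem_lcs π hb5
  have h5π : ∀ g, π g ^ 5 ∈ lcs (G ⧸ lcs G 3) 1 := fun g ↦ map_pow π g 5 ▸ map_mem_lcs π (h5 g)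
  refine cases_of_eigenvalues hbot hcard hSπ hind ?_ ?_ σ' hl hm' hlm (hσ' hx) (hσ' hy)
  · exact pow_five_mem_lcs_two hbot hSπ hb5π (h5π x) fun i hi ↦
      (hind i 0 (by rwa [zpow_zero, mul_one])).1
  · exact pow_five_mem_lcs_two hbot hSπ hb5π (h5π y) fun i hi ↦
      (hind 0 i (by rwa [zpow_zero, one_mul])).2

end Classification

theorem mainTheorem8 :
    (IsSchurSigmaGroup 5 G3125_11 ∧ IsSchurSigmaGroup 5 G3125_14) ∧
    (IsCapable 5 G3125_3 ∧ IsCapable 5 G3125_4 ∧ IsCapable 5 G3125_5 ∧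
      IsCapable 5 G3125_6 ∧ IsCapable 5 G3125_7) ∧
    ∀ (G : Type*) [Group G] [Finite G], IsPGroup 5 G →
      Nonempty (Abelianization G ≃* Multiplicative (ZMod 5 × ZMod 5)) →
      IsMetabelian G →
      IsSigmaGroup 4 G →
        HasCoclass 5 G 1 ∨
        (Nonempty (G ≃* G3125_11) ∨ Nonempty (G ≃* G3125_14)) ∨
        (IsDescendant G G3125_3 ∨ IsDescendant G G3125_4 ∨ IsDescendant G G3125_5 ∨
          IsDescendant G G3125_6 ∨ IsDescendant G G3125_7) := by
  refine ⟨⟨Phi6Group.isSchurSigmaGroup (by norm_num) (by norm_num),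
    Phi6Group.isSchurSigmaGroup (by norm_num) (by norm_num)⟩,
    ⟨isCapable_phi6Group 0 0, isCapable_phi6Group 1 0, isCapable_phi6Group 0 1,
      isCapable_phi6Group 0 2, isCapable_phi6Group_four_one⟩, ?_⟩
  intro G _ _ hG hA hm hσ
  by_cases hco : HasCoclass 5 G 1
  · exact Or.inl hco
  refine Or.inr ?_
  rcases cases_quotient hG hA hm hσ hco with (h | h) | h | h | h | h | h
  · exact Or.inl (Or.inl (nonempty_mulEquiv_of_quotient hG (by norm_num) (by norm_num) h))
  · exact Or.inl (Or.inr (nonempty_mulEquiv_of_quotient hG (by norm_num) (by norm_num) h))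
  · exact Or.inr (Or.inl ⟨3, h⟩)
  · exact Or.inr (Or.inr (Or.inl ⟨3, h⟩))
  · exact Or.inr (Or.inr (Or.inr (Or.inl ⟨3, h⟩)))
  · exact Or.inr (Or.inr (Or.inr (Or.inr (Or.inl ⟨3, h⟩))))
  · exact Or.inr (Or.inr (Or.inr (Or.inr (Or.inr ⟨3, h⟩))))
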